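/- For a group $\Gamma$, a word $v$ in the free group $F(X_1,X_2,\dots)$ is a law of $\Gamma$ if every substitution of elements of $\Gamma$ for the variables sends $v$ to $1$. For a finite alphabet $\Sigma$, let $\langle\mathfrak w_\Gamma\rangle\le F(\Sigma)$ be the verbal subgroup generated by all values in $F(\Sigma)$ of the laws of $\Gamma$. Let $\Gamma$ be a finitely generated torsion-free nilpotent group. Then, for every finite alphabet $\Sigma$, a word $w\in F(\Sigma)$ lies in $\langle\mathfrak w_\Gamma\rangle$ if and only if $w$ is a law of $\Gamma$ (that is, $w$ is trivial under every homomorphism $F(\Sigma)\to\Gamma$), and there is an algorithm that, given $\Sigma$ and $w$, determines whether $w\in\langle\mathfrak w_\Gamma\rangle$. Moreover the algorithm can be chosen uniformly in $\Gamma$: there is a single algorithm that, given a finite presentation of any finitely generated torsion-free nilpotent group $\Gamma$, a finite alphabet $\Sigma$ and a word $w\in F(\Sigma)$, halts and determines whether $w\in\langle\mathfrak w_\Gamma\rangle$. -/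

import Mathlib

namespace GroupLaw

universe u v

/-- The set `G_w` of values of a word `w` in a group `G`: all elements obtained by substituting
elements of `G` for the variables of `w`. -/
def values {α : Type u} (w : FreeGroup α) (G : Type v) [Group G] : Set G :=
  {x | ∃ g : α → G, x = FreeGroup.lift g w}

/-- A word `w` is a law of `G` if its only value in `G` is `1`. -/
def IsLaw {α : Type u} (w : FreeGroup α) (G : Type v) [Group G] : Prop :=
  values w G = {1}

/-- The set of all laws of `G`, among the words in countably many variables `X₀, X₁, …`. -/
def laws (G : Type v) [Group G] : Set (FreeGroup ℕ) :=
  {w | IsLaw w G}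

/-- The verbal subgroup of `H` determined by a set `W` of words: the subgroup generated by all
values in `H` of the words in `W`. -/
def verbalSubgroup (W : Set (FreeGroup ℕ)) (H : Type v) [Group H] : Subgroup H :=
  Subgroup.closure {x | ∃ w ∈ W, x ∈ values w H}

/-- The finite list `R` of words in the letters `x₀, …, x_{m-1}` and their inverses is the list of
relators of a presentation `⟨x₀, …, x_{m-1} | R⟩` of `G`. Here `(i, true)` is the letter `xᵢ` and
`(i, false)` is its inverse. -/
def Presents {m : ℕ} (R : List (List (Fin m × Bool))) (G : Type v) [Group G] : Prop :=
  Nonempty (PresentedGroup {r : FreeGroup (Fin m) | ∃ u ∈ R, r = FreeGroup.mk u} ≃* G)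

/-- A word over the alphabet of size `k` as a finite piece of data: the list of its letters, each
recorded by its index and its sign. -/
def code {k : ℕ} (u : List (Fin k × Bool)) : List (ℕ × Bool) :=
  u.map fun l => (l.1.val, l.2)

end GroupLaw

namespace GroupLaw

open Subgroup
open scoped commutatorElement

/-! ### Filtrations of groups and cube groups -/

/-! The equivalence is formal: a homomorphism to `Γ` carries values of laws to values of laws, so it
kills the verbal subgroup; conversely a law `w` is its own value at the generators.

Decidability comes from two semi-algorithms run in parallel on a presentation.

Being a law is semi-decidable because, in class `c`, it suffices to test finitely many tuples: those
whose entries are products of at most `c` generators and inverses (`lift_eq_one_of_isShort`). To see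
this, write arbitrary arguments as products of such letters and, for a finite set `T` of letter
positions, let `f T` be the value of the word after deleting all letters outside `T`. As a function
on a cube, `f` is polynomial with respect to the lower central series: such functions form a group
(`isFiltration_derived`) which contains the switches "letter if its position is in `T`, else `1`".
If `f` vanishes on all proper subsets of `T`, then `f T` is an iterated difference and lies in the
term of index `T.card` of the filtration `G, G, γ₂ G, …`, which is trivial once `T.card > c`. So `f`
vanishes everywhere if it vanishes for `T.card ≤ c`, where only short arguments occur. A bound on
the class is itself certified by killing the left-normed commutators of generators
(`lowerCentralSeries_eq_bot_of_leftNormedCommutators`), so the class need not be part of the input.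
Both checks are finite lists of consequences of the relators, found by enumerating products of
conjugates.

Not being a law is semi-decidable because finitely generated nilpotent groups are residually finite:
a nontrivial value survives in a finite quotient, that is, in a finite permutation action satisfying
the relators, which can be searched for.

Each certificate is checked primitive recursively, so the joint search is partial recursive, and it
halts on every admissible presentation. For a fixed group, finite presentability supplies a
presentation to insert as a constant. -/

/-- A descending chain of subgroups with `⁅A i, A j⁆ ≤ A (i + j)`. -/
structure IsFiltration {G : Type*} [Group G] (A : ℕ → Subgroup G) : Prop where
  le_of_succ : ∀ i, A (i + 1) ≤ A i
  commutator_le : ∀ i j, ⁅A i, A j⁆ ≤ A (i + j)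

namespace IsFiltration

variable {G H : Type*} [Group G] [Group H] {A : ℕ → Subgroup G}

theorem antitone (hA : IsFiltration A) : Antitone A :=
  antitone_nat_of_succ_le hA.le_of_succ

theorem commutator_mem (hA : IsFiltration A) {i j : ℕ} {x y : G} (hx : x ∈ A i) (hy : y ∈ A j) :
    ⁅x, y⁆ ∈ A (i + j) :=
  hA.commutator_le i j (commutator_mem_commutator hx hy)

theorem conj_mem (hA : IsFiltration A) {i j : ℕ} {x y : G} (hx : x ∈ A i) (hy : y ∈ A j) :
    x * y * x⁻¹ ∈ A j := by
  have h := mul_mem (hA.antitone (Nat.le_add_left j i) (hA.commutator_mem hx hy)) hy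
  simpa [commutatorElement_def] using h

theorem conj_mem' (hA : IsFiltration A) {i j : ℕ} {x y : G} (hx : x ∈ A i) (hy : y ∈ A j) :
    x⁻¹ * y * x ∈ A j := by
  simpa using hA.conj_mem (inv_mem hx) hy

theorem comap (hA : IsFiltration A) (f : H →* G) : IsFiltration fun i => (A i).comap f where
  le_of_succ i := Subgroup.comap_mono (hA.le_of_succ i)
  commutator_le i j := by
    rw [Subgroup.commutator_le]
    intro x hx y hy
    rw [mem_comap, map_commutatorElement]
    exact hA.commutator_mem hx hy

/-- The elements of `A i` that an endomorphism `σ` moves by an element of `A (i + 1)` only. -/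
def derived (hA : IsFiltration A) (σ : G →* G) (i : ℕ) : Subgroup G where
  carrier := {a | a ∈ A i ∧ a⁻¹ * σ a ∈ A (i + 1)}
  one_mem' := by simp [one_mem]
  mul_mem' := by
    rintro a b ⟨ha, ha'⟩ ⟨hb, hb'⟩
    refine ⟨mul_mem ha hb, ?_⟩
    have h := mul_mem (hA.conj_mem' hb ha') hb'
    convert h using 1
    simp [mul_assoc]
  inv_mem' := by
    rintro a ⟨ha, ha'⟩
    refine ⟨inv_mem ha, ?_⟩
    have h := hA.conj_mem ha (inv_mem ha')
    convert h using 1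
    simp [mul_assoc]

/-- This is the reason that polynomial functions are closed under multiplication: taking differences
along `σ` loses nothing of the commutator estimates, so the construction can be iterated. -/
theorem isFiltration_derived (hA : IsFiltration A) (σ : G →* G) :
    IsFiltration (hA.derived σ) where
  le_of_succ i a ha := ⟨hA.le_of_succ _ ha.1, hA.le_of_succ _ ha.2⟩
  commutator_le i j := by
    rw [Subgroup.commutator_le]
    rintro x ⟨hx, hx'⟩ y ⟨hy, hy'⟩
    refine ⟨hA.commutator_mem hx hy, ?_⟩
    obtain ⟨h, hh⟩ : ∃ h, h = x⁻¹ * σ x := ⟨_, rfl⟩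
    obtain ⟨k, hk⟩ : ∃ k, k = y⁻¹ * σ y := ⟨_, rfl⟩
    have e1 : σ x = x * h := by simp [hh]
    have e2 : σ y = y * k := by simp [hk]
    rw [← hh] at hx'
    rw [← hk] at hy'
    -- Expand `⁅x * h, y * k⁆` in each argument; the factor `⁅x, y⁆` cancels and the remaining
    -- commutators each contain `h` or `k`, hence lie one level deeper.
    have key : ⁅x, y⁆⁻¹ * σ ⁅x, y⁆ =
        (⁅x, y⁆⁻¹ * (x * ⁅h, y * k⁆ * x⁻¹) * ⁅x, y⁆) * (y * ⁅x, k⁆ * y⁻¹) := by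
      rw [map_commutatorElement, e1, e2]
      simp only [commutatorElement_def]
      group
    rw [key]
    have h1 : ⁅h, y * k⁆ ∈ A (i + j + 1) := by
      have := hA.commutator_mem hx' (mul_mem hy (hA.le_of_succ _ hy'))
      rwa [show i + 1 + j = i + j + 1 by ring] at this
    have h2 : ⁅x, k⁆ ∈ A (i + (j + 1)) := hA.commutator_mem hx hy'
    exact mul_mem (hA.conj_mem' (hA.commutator_mem hx hy) (hA.conj_mem hx h1)) (hA.conj_mem hy h2)

end IsFiltration

section Cube

variable {G : Type*} [Group G] {Y : Type*} [DecidableEq Y]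

/-- Precomposition with the insertion of `y`. -/
def insertHom (G : Type*) [Group G] {Y : Type*} [DecidableEq Y] (y : Y) :
    (Finset Y → G) →* (Finset Y → G) where
  toFun f T := f (insert y T)
  map_one' := rfl
  map_mul' _ _ := rfl

/-- The filtered group of those functions on finite sets whose iterated differences, in the
directions of the listed elements, descend in the filtration `A` of the group of values. -/
def cube {A : ℕ → Subgroup G} (hA : IsFiltration A) :
    List Y → {B : ℕ → Subgroup (Finset Y → G) // IsFiltration B}
  | [] => ⟨_, hA.comap (Pi.evalMonoidHom (fun _ : Finset Y => G) ∅)⟩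
  | y :: l => ⟨_, (cube hA l).2.isFiltration_derived (insertHom G y)⟩

variable {A : ℕ → Subgroup G} (hA : IsFiltration A)

theorem mem_cube_nil {i : ℕ} {f : Finset Y → G} : f ∈ (cube hA []).1 i ↔ f ∅ ∈ A i := Iff.rfl

theorem mem_cube_cons {y : Y} {l : List Y} {i : ℕ} {f : Finset Y → G} :
    f ∈ (cube hA (y :: l)).1 i ↔
      f ∈ (cube hA l).1 i ∧ f⁻¹ * insertHom G y f ∈ (cube hA l).1 (i + 1) := Iff.rfl

theorem const_mem_cube (l : List Y) {i : ℕ} {g : G} (hg : g ∈ A i) :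
    (fun _ => g) ∈ (cube hA l).1 i := by
  induction l with
  | nil => exact hg
  | cons y l ih =>
    refine (mem_cube_cons hA).2 ⟨ih, ?_⟩
    convert one_mem ((cube hA l).1 (i + 1)) using 1
    ext T
    simp [insertHom]

/-- The switch at `y` is trivial at `∅` and constant in all directions other than `y`, so it lies in
every level. -/
theorem ite_mem_cube_of_notMem {l : List Y} {y : Y} (hy : y ∉ l) (i : ℕ) (g : G) :
    (fun T : Finset Y => if y ∈ T then g else 1) ∈ (cube hA l).1 i := by
  induction l generalizing i with
  | nil => simp [mem_cube_nil, one_mem]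
  | cons z l ih =>
    rw [List.mem_cons, not_or] at hy
    refine (mem_cube_cons hA).2 ⟨ih hy.2 i, ?_⟩
    convert one_mem ((cube hA l).1 (i + 1)) using 1
    ext T
    by_cases h : y ∈ T <;> simp [insertHom, hy.1, h]

theorem ite_mem_cube {l : List Y} (hl : l.Nodup) (y : Y) {i : ℕ} {g : G}
    (h1 : g ∈ A (i + 1)) : (fun T : Finset Y => if y ∈ T then g else 1) ∈ (cube hA l).1 i := by
  induction l with
  | nil => simp [mem_cube_nil, one_mem]
  | cons z l ih =>
    rw [List.nodup_cons] at hl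
    refine (mem_cube_cons hA).2 ⟨ih hl.2, ?_⟩
    by_cases hyz : y = z
    · subst hyz
      -- In its own direction the difference of the switch is the inverse switch times the constant
      -- `g`. The switch lies in all levels because `y` is not in the tail; only the constant needs
      -- `g ∈ A (i + 1)`.
      refine mul_mem (inv_mem (ite_mem_cube_of_notMem hA hl.1 _ g)) ?_
      convert const_mem_cube hA l h1
      simp [insertHom]
    · convert one_mem ((cube hA l).1 (i + 1)) using 1
      ext T
      by_cases h : y ∈ T <;> simp [insertHom, hyz, h]

/-- When all proper subsets give `1`, the iterated difference at `∅` collapses to its top term, and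
each direction has raised the level by one. -/
theorem apply_mem_of_mem_cube {l : List Y} (hl : l.Nodup) {i : ℕ} {f : Finset Y → G}
    (hf : f ∈ (cube hA l).1 i) (h : ∀ T, T ⊂ l.toFinset → f T = 1) :
    f l.toFinset ∈ A (i + l.length) := by
  induction l generalizing i f with
  | nil => exact hf
  | cons y l ih =>
    rw [List.nodup_cons] at hl
    have hy : y ∉ l.toFinset := by simpa using hl.1
    have e : (f⁻¹ * insertHom G y f) l.toFinset = f (y :: l).toFinset := by
      have := h l.toFinset (by
        rw [List.toFinset_cons]; exact Finset.ssubset_insert hy)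
      simp [insertHom, this]
    rw [← e, List.length_cons, show i + (l.length + 1) = i + 1 + l.length by ring]
    refine ih hl.2 hf.2 fun T hT => ?_
    have h1 : f T = 1 := h T (hT.trans (by
      rw [List.toFinset_cons]; exact Finset.ssubset_insert hy))
    have h2 : f (insert y T) = 1 := h _ (by
      rw [List.toFinset_cons]
      refine (Finset.insert_subset_insert y hT.1).ssubset_of_ne fun heq => hT.2 ?_
      intro a ha
      have : a ∈ insert y T := heq ▸ Finset.mem_insert_of_mem ha
      rcases Finset.mem_insert.1 this with rfl | h
      · exact absurd ha hy
      · exact h)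
    simp [insertHom, h1, h2]

end Cube

/-! ### The lower central series as a filtration -/

/-- The three subgroups lemma modulo `N`, obtained by passing to the quotient. -/
theorem commutator_commutator_le_of_rotate {G : Type*} [Group G] {H₁ H₂ H₃ N : Subgroup G}
    [N.Normal] (h1 : ⁅⁅H₂, H₃⁆, H₁⁆ ≤ N) (h2 : ⁅⁅H₃, H₁⁆, H₂⁆ ≤ N) : ⁅⁅H₁, H₂⁆, H₃⁆ ≤ N := by
  rw [← QuotientGroup.ker_mk' N, ← Subgroup.map_eq_bot_iff] at *
  simp only [map_commutator] at *
  exact commutator_commutator_eq_bot_of_rotate h1 h2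

theorem commutator_lowerCentralSeries_le (G : Type*) [Group G] (i j : ℕ) :
    ⁅(⊤ : Subgroup G).lowerCentralSeries i, (⊤ : Subgroup G).lowerCentralSeries j⁆ ≤
      (⊤ : Subgroup G).lowerCentralSeries (i + j + 1) := by
  induction j generalizing i with
  | zero => rfl
  | succ j ih =>
    rw [Subgroup.lowerCentralSeries_succ _ j, commutator_comm]
    refine commutator_commutator_le_of_rotate ?_ ?_
    · rw [commutator_comm ⊤, ← Subgroup.lowerCentralSeries_succ]
      exact (ih (i + 1)).trans (le_of_eq (by congr 1; ring))
    · exact commutator_mono (ih i) le_rfl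

/-- The filtration `G, G, γ₂ G, γ₃ G, …`. -/
theorem isFiltration_lowerCentralSeries (G : Type*) [Group G] :
    IsFiltration fun i => (⊤ : Subgroup G).lowerCentralSeries (i - 1) where
  le_of_succ i := Subgroup.lowerCentralSeries_antitone _ (by omega)
  commutator_le i j := by
    rcases Nat.eq_zero_or_pos i with rfl | hi
    · simpa using commutator_le_right _ _
    rcases Nat.eq_zero_or_pos j with rfl | hj
    · simpa using commutator_le_left _ _
    · exact (commutator_lowerCentralSeries_le G _ _).trans
        (Subgroup.lowerCentralSeries_antitone _ (by omega))

/-! ### Laws of nilpotent groups are detected on short words -/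

/-- In a group of class `c`, a function that lies in all cube groups is trivial if it vanishes on
all sets of size at most `c`. -/
theorem eq_one_of_forall_card_le {G : Type*} [Group G] {Y : Type*} [DecidableEq Y] {c : ℕ}
    (hc : (⊤ : Subgroup G).lowerCentralSeries c = ⊥) {f : Finset Y → G}
    (hf : ∀ l : List Y, l.Nodup → f ∈ (cube (isFiltration_lowerCentralSeries G) l).1 0)
    (h : ∀ T : Finset Y, T.card ≤ c → f T = 1) (T : Finset Y) : f T = 1 := by
  induction T using Finset.strongInduction with
  | H T ih =>
    rcases le_or_gt T.card c with hT | hT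
    · exact h T hT
    · have := apply_mem_of_mem_cube (isFiltration_lowerCentralSeries G) T.nodup_toList
        (hf _ T.nodup_toList) (by simpa using ih)
      rw [Finset.toList_toFinset, Finset.length_toList] at this
      -- `lowerCentralSeries` starts at index `0`, so the filtration level `T.card` is its term
      -- `T.card - 1`; this is why `c < T.card` suffices.
      have h' := Subgroup.lowerCentralSeries_antitone (⊤ : Subgroup G)
        (show c ≤ 0 + T.card - 1 by omega) this
      simpa [hc] using h'

/-- A product of at most `c` values of `s`. -/
def IsShort {G : Type*} [Group G] {ι : Type*} (s : ι → G) (c : ℕ) (g : G) : Prop :=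
  ∃ l : List ι, l.length ≤ c ∧ g = (l.map s).prod

/-- The predicate `p` restricts to finitely many active variables, so that all letter positions
together form a finite set. -/
theorem lift_eq_one_of_isShort {G : Type*} [Group G] {c : ℕ}
    (hc : (⊤ : Subgroup G).lowerCentralSeries c = ⊥) {ι : Type*} {s : ι → G}
    (hs : ∀ g, ∃ l : List ι, g = (l.map s).prod) {κ : Type*} (w : FreeGroup κ)
    {p : κ → Prop} (hp : {j | p j}.Finite)
    (h : ∀ g : κ → G, (∀ j, IsShort s c (g j)) → (∀ j, ¬ p j → g j = 1) → FreeGroup.lift g w = 1)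
    (g : κ → G) (hg : ∀ j, ¬ p j → g j = 1) : FreeGroup.lift g w = 1 := by
  classical
  choose! L hL using hs
  let L' : κ → List ι := fun j => if p j then L (g j) else []
  have hL' : ∀ j, g j = ((L' j).map s).prod := by
    intro j
    by_cases hj : p j
    · simp only [L', hj, if_true]; exact hL _
    · simp [L', hj, hg j hj]
  -- Keep in the `j`th argument only the letters whose position is in `T`. Positions, not letters,
  -- index the cube, since a letter may be repeated.
  let F : κ → Finset (κ × ℕ) → G := fun j =>
    ((L' j).zipIdx.map fun a => fun T : Finset (κ × ℕ) => if (j, a.2) ∈ T then s a.1 else 1).prod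
  have hF : ∀ j T, F j T =
      (((L' j).zipIdx.filter fun a => (j, a.2) ∈ T).map fun a => s a.1).prod := by
    intro j T
    simp only [F]
    generalize (L' j).zipIdx = M
    induction M with
    | nil => rfl
    | cons a M ih =>
      rw [List.map_cons, List.prod_cons, Pi.mul_apply, ih]
      by_cases ha : (j, a.2) ∈ T <;> simp [ha]
  let f : Finset (κ × ℕ) → G := FreeGroup.lift F w
  have hfT : ∀ T, f T = FreeGroup.lift (fun j => F j T) w := by
    intro T
    have : (Pi.evalMonoidHom (fun _ : Finset (κ × ℕ) => G) T).comp (FreeGroup.lift F) =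
        FreeGroup.lift (fun j => F j T) := by
      ext j; simp
    exact DFunLike.congr_fun this w
  have hf : ∀ T, f T = 1 := by
    refine eq_one_of_forall_card_le hc ?_ ?_
    · intro l hl
      have : (FreeGroup.lift F).range ≤ (cube (isFiltration_lowerCentralSeries G) l).1 0 := by
        refine FreeGroup.range_lift_le (Set.range_subset_iff.2 fun j => ?_)
        refine list_prod_mem fun x hx => ?_
        obtain ⟨a, -, rfl⟩ := List.mem_map.1 hx
        exact ite_mem_cube _ hl _ (by simp)
      exact this ⟨w, rfl⟩
    · intro T hT
      rw [hfT]
      refine h _ (fun j => ?_) fun j hj => ?_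
      · refine ⟨((L' j).zipIdx.filter fun a => (j, a.2) ∈ T).map Prod.fst, ?_, ?_⟩
        · rw [List.length_map]
          refine le_trans ?_ hT
          -- Kept letters have distinct positions in `T`, so there are at most `T.card ≤ c` of them.
          have hnd : (((L' j).zipIdx.filter fun a => (j, a.2) ∈ T).map
              fun a => (j, a.2)).Nodup := by
            have h2 : ((L' j).zipIdx.map Prod.snd).Nodup := by
              rw [List.zipIdx_map_snd]; exact List.nodup_range' 
            have h3 := (List.filter_sublist (p := fun a => decide ((j, a.2) ∈ T))
              (l := (L' j).zipIdx)).map Prod.snd |>.nodup h2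
            have := h3.map (f := fun n => (j, n)) fun a b hab => (Prod.mk.inj hab).2
            simpa [List.map_map, Function.comp_def] using this
          rw [← List.length_map (f := fun a : ι × ℕ => (j, a.2)),
            ← List.toFinset_card_of_nodup hnd]
          refine Finset.card_le_card fun x hx => ?_
          simp only [List.mem_toFinset, List.mem_map, List.mem_filter, decide_eq_true_eq] at hx
          obtain ⟨a, ha, rfl⟩ := hx
          exact ha.2
        · rw [hF, List.map_map]; rfl
      · rw [hF]; simp [L', hj]
  -- Switching on all positions recovers the original arguments.
  have hg' : g = fun j => F j (hp.toFinset.biUnion fun j =>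
      (Finset.range (L' j).length).image fun n => (j, n)) := by
    ext j
    rw [hF, List.filter_eq_self.2, hL' j]
    · conv_lhs => rw [← List.zipIdx_map_fst 0 (L' j), List.map_map]
      rfl
    · rintro ⟨a, n⟩ ha
      have hn := List.snd_lt_of_mem_zipIdx ha
      have hj : p j := by
        by_contra hj
        simp [L', hj] at ha
      simp only [Finset.mem_biUnion, Finset.mem_image, Finset.mem_range, decide_eq_true_eq,
        Set.Finite.mem_toFinset, Set.mem_ofPred_eq]
      exact ⟨j, hj, n, by omega, rfl⟩
  rw [hg', ← hfT]
  exact hf _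

end GroupLaw

namespace GroupLaw

open Subgroup
open scoped commutatorElement

/-! ### Commutators of generators -/

/-- The left-normed commutators of `n + 1` elements of `S`. -/
def leftNormedCommutators {G : Type*} [Group G] (S : Set G) : ℕ → Set G
  | 0 => S
  | n + 1 => {z | ∃ x ∈ leftNormedCommutators S n, ∃ s ∈ S, z = ⁅x, s⁆}

theorem finite_leftNormedCommutators {G : Type*} [Group G] {S : Set G} (hS : S.Finite) (n : ℕ) :
    (leftNormedCommutators S n).Finite := by
  induction n with
  | zero => exact hS
  | succ n ih =>
    refine ((ih.prod hS).image fun a : G × G => ⁅a.1, a.2⁆).subset ?_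
    rintro z ⟨x, hx, s, hs, rfl⟩
    exact ⟨(x, s), ⟨hx, hs⟩, rfl⟩

theorem image_leftNormedCommutators {G H : Type*} [Group G] [Group H] (f : G →* H) (S : Set G)
    (n : ℕ) : f '' leftNormedCommutators S n = leftNormedCommutators (f '' S) n := by
  induction n with
  | zero => rfl
  | succ n ih =>
    ext z
    simp only [leftNormedCommutators, ← ih]
    constructor
    · rintro ⟨_, ⟨x, hx, s, hs, rfl⟩, rfl⟩
      exact ⟨f x, ⟨x, hx, rfl⟩, f s, ⟨s, hs, rfl⟩, map_commutatorElement f x s⟩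
    · rintro ⟨_, ⟨x, hx, rfl⟩, _, ⟨s, hs, rfl⟩, rfl⟩
      exact ⟨⁅x, s⁆, ⟨x, hx, s, hs, rfl⟩, map_commutatorElement f x s⟩

theorem leftNormedCommutators_subset {G : Type*} [Group G] (S : Set G) (n : ℕ) :
    leftNormedCommutators S n ⊆ (⊤ : Subgroup G).lowerCentralSeries n := by
  induction n with
  | zero => intro x _; exact mem_top x
  | succ n ih =>
    rintro z ⟨x, hx, s, hs, rfl⟩
    exact commutator_mem_commutator (ih hx) (mem_top s)

/-- Modulo the commutators of the next weight, those of the present weight commute with all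
generators, hence are central; so is then their normal closure. -/
theorem lowerCentralSeries_le_normalClosure {G : Type*} [Group G] {S : Set G}
    (hS : closure S = ⊤) (n : ℕ) :
    (⊤ : Subgroup G).lowerCentralSeries n ≤ normalClosure (leftNormedCommutators S n) := by
  induction n with
  | zero =>
    rw [Subgroup.lowerCentralSeries_zero, ← hS]
    exact closure_le_normalClosure
  | succ n ih =>
    set N := normalClosure (leftNormedCommutators S (n + 1)) with hN
    have h1 : leftNormedCommutators S n ⊆ (center (G ⧸ N)).comap (QuotientGroup.mk' N) := by
      intro x hx
      have h2 : closure S ≤ (centralizer {(x : G ⧸ N)}).comap (QuotientGroup.mk' N) := by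
        rw [closure_le]
        intro s hs
        have : ⁅x, s⁆ ∈ N := subset_normalClosure ⟨x, hx, s, hs, rfl⟩
        rw [← QuotientGroup.eq_one_iff] at this
        change QuotientGroup.mk' N ⁅x, s⁆ = 1 at this
        rw [map_commutatorElement, commutatorElement_eq_one_iff_mul_comm] at this
        exact mem_centralizer_singleton_iff.2 this.symm
      rw [SetLike.mem_coe, mem_comap, mem_center_iff]
      intro g
      obtain ⟨g, rfl⟩ := QuotientGroup.mk'_surjective N g
      exact mem_centralizer_singleton_iff.1 (h2 (hS ▸ mem_top g))
    have h3 := ih.trans (normalClosure_le_normal h1)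
    rw [Subgroup.lowerCentralSeries_succ, Subgroup.commutator_le]
    intro x hx g _
    have := mem_center_iff.1 (h3 hx) (g : G ⧸ N)
    rw [← QuotientGroup.eq_one_iff]
    change QuotientGroup.mk' N ⁅x, g⁆ = 1
    rw [map_commutatorElement, commutatorElement_eq_one_iff_mul_comm]
    exact this.symm

theorem lowerCentralSeries_eq_bot_of_leftNormedCommutators {G : Type*} [Group G] {S : Set G}
    (hS : closure S = ⊤) {n : ℕ} (h : ∀ x ∈ leftNormedCommutators S n, x = 1) :
    (⊤ : Subgroup G).lowerCentralSeries n = ⊥ :=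
  le_bot_iff.1 <| (lowerCentralSeries_le_normalClosure hS n).trans <|
    normalClosure_le_normal fun x hx => mem_bot.2 (h x hx)

/-! ### Subgroups of finitely generated nilpotent groups -/

theorem fg_of_map_mk {G : Type*} [Group G] {N H : Subgroup G} [N.Normal] (h1 : (H ⊓ N).FG)
    (h2 : (H.map (QuotientGroup.mk' N)).FG) : H.FG := by
  classical
  obtain ⟨T, hT⟩ := h2
  have hsub : (T : Set (G ⧸ N)) ⊆ QuotientGroup.mk' N '' H := by
    rw [← coe_map, ← hT]; exact subset_closure
  obtain ⟨T', hT', rfl⟩ := Finset.subset_set_image_iff.1 hsub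
  rw [Finset.coe_image, ← MonoidHom.map_closure] at hT
  have : H = Subgroup.closure (T' : Set G) ⊔ H ⊓ N := by
    refine le_antisymm (fun x hx => ?_) (sup_le ((closure_le H).2 hT') inf_le_left)
    obtain ⟨t, ht, htx⟩ : QuotientGroup.mk' N x ∈ (Subgroup.closure (T' : Set G)).map _ :=
      hT ▸ mem_map_of_mem _ hx
    have htH : t ∈ H := (closure_le H).2 hT' ht
    rw [← mul_inv_cancel_left t x]
    exact mul_mem_sup ht ⟨H.mul_mem (H.inv_mem htH) hx, QuotientGroup.eq.1 htx⟩
  rw [this]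
  exact Subgroup.FG.sup ⟨T', rfl⟩ h1

theorem fg_subgroup_of_commGroup {A : Type*} [CommGroup A] [Group.FG A] (H : Subgroup A) :
    H.FG := by
  have : Module.Finite ℤ (Additive A) :=
    Module.Finite.iff_addGroup_fg.2 (GroupFG.iff_add_fg.1 inferInstance)
  rw [Subgroup.fg_iff_add_fg, ← AddSubgroup.toIntSubmodule_toAddSubgroup H.toAddSubgroup,
    ← Submodule.fg_iff_addSubgroup_fg]
  exact IsNoetherian.noetherian _

theorem fg_of_le_center {G : Type*} [Group G] {C H : Subgroup G} (hC : C.FG) (hc : C ≤ center G)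
    (hH : H ≤ C) : H.FG := by
  let : CommGroup C := { mul_comm := fun a b => Subtype.ext (mem_center_iff.1 (hc b.2) a) }
  have : Group.FG C := (Group.fg_iff_subgroup_fg C).2 hC
  have h := fg_subgroup_of_commGroup (H.subgroupOf C)
  rw [← Group.fg_iff_subgroup_fg] at h ⊢
  exact Group.fg_of_surjective (f := (subgroupOfEquivOfLe hH).toMonoidHom)
    (subgroupOfEquivOfLe hH).surjective

theorem finite_of_le_center {G : Type*} [Group G] {C : Subgroup G} (hC : C.FG)
    (hc : C ≤ center G) (h : ∀ z ∈ C, IsOfFinOrder z) : Finite C := by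
  let : CommGroup C := { mul_comm := fun a b => Subtype.ext (mem_center_iff.1 (hc b.2) a) }
  have : Group.FG C := (Group.fg_iff_subgroup_fg C).2 hC
  exact CommGroup.finite_of_fg_isMulTorsion C fun z => Submonoid.isOfFinOrder_coe.1 (h z z.2)

theorem fg_subgroup_of_lowerCentralSeries_eq_bot (c : ℕ) {G : Type*} [Group G] [hG : Group.FG G]
    (hc : (⊤ : Subgroup G).lowerCentralSeries c = ⊥) (H : Subgroup G) : H.FG := by
  induction c generalizing G with
  | zero =>
    have : H = ⊥ := le_bot_iff.1 (hc ▸ le_top)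
    exact this ▸ Subgroup.FG.bot
  | succ c ih =>
    obtain ⟨S, hS, hfin⟩ := Group.fg_iff.1 hG
    set C := (⊤ : Subgroup G).lowerCentralSeries c with hC
    have hCc : C ≤ center G := by
      rw [← commutator_top_right_eq_bot_iff_le_center]; exact hc
    have hCfg : C.FG := by
      refine (Subgroup.fg_iff C).2
        ⟨leftNormedCommutators S c, le_antisymm ?_ ?_, finite_leftNormedCommutators hfin c⟩
      · exact (closure_le C).2 (leftNormedCommutators_subset S c)
      -- The last nontrivial term is central, so the commutators generate it without taking
      -- conjugates.
      · have : (closure (leftNormedCommutators S c)).Normal := by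
          refine ⟨fun x hx g => ?_⟩
          have := mem_center_iff.1
            (hCc ((closure_le C).2 (leftNormedCommutators_subset S c) hx)) g
          rwa [this, mul_inv_cancel_right]
        exact (lowerCentralSeries_le_normalClosure hS c).trans
          (normalClosure_le_normal subset_closure)
    refine fg_of_map_mk (N := C) (fg_of_le_center hCfg hCc inf_le_right) (ih ?_ _)
    rw [← Subgroup.map_top_of_surjective _ (QuotientGroup.mk'_surjective C),
      ← Subgroup.map_lowerCentralSeries, ← hC, QuotientGroup.map_mk'_self]

theorem fg_subgroup_of_isNilpotent {G : Type*} [Group G] [Group.FG G] [Group.IsNilpotent G]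
    (H : Subgroup G) : H.FG := by
  obtain ⟨c, hc⟩ := Subgroup.nilpotent_iff_lowerCentralSeries.1 ‹Group.IsNilpotent G›
  exact fg_subgroup_of_lowerCentralSeries_eq_bot c hc H

/-- Finitely generated nilpotent groups are finitely presented. -/
theorem isFinitelyPresented_of_isNilpotent (G : Type*) [Group G] [hG : Group.FG G]
    [hn : Group.IsNilpotent G] : Group.IsFinitelyPresented G := by
  obtain ⟨c, hc⟩ := Subgroup.nilpotent_iff_lowerCentralSeries.1 hn
  obtain ⟨α, _, φ, hφ⟩ := Group.fg_iff_exists_freeGroup_hom_surjective_finite.1 hG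
  set N := leftNormedCommutators (Set.range (FreeGroup.of : α → FreeGroup α)) c with hN
  have hNfin : Finite N := finite_leftNormedCommutators (Set.finite_range _) c
  have hE : (⊤ : Subgroup (PresentedGroup N)).lowerCentralSeries c = ⊥ := by
    refine lowerCentralSeries_eq_bot_of_leftNormedCommutators
      (S := PresentedGroup.mk N '' Set.range FreeGroup.of) ?_ ?_
    · rw [← MonoidHom.map_closure, FreeGroup.closure_range_of,
        map_top_of_surjective _ (PresentedGroup.mk_surjective N)]
    · rw [← image_leftNormedCommutators]
      rintro _ ⟨x, hx, rfl⟩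
      exact PresentedGroup.one_of_mem hx
  -- `PresentedGroup N` is finitely presented and nilpotent, so the kernel of its map onto `G` is
  -- finitely generated: finitely many further relators present `G`.
  have hφN : normalClosure N ≤ φ.ker := by
    refine normalClosure_le_normal fun x hx => ?_
    have := mem_map_of_mem φ (leftNormedCommutators_subset _ c hx)
    rwa [Subgroup.map_lowerCentralSeries, map_top_of_surjective φ hφ, hc] at this
  let ψ : PresentedGroup N →* G := QuotientGroup.lift _ φ hφN
  have hψ : Function.Surjective ψ := fun g => by
    obtain ⟨x, rfl⟩ := hφ g
    exact ⟨PresentedGroup.mk N x, rfl⟩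
  have : Group.FG (PresentedGroup N) := Group.fg_of_surjective (PresentedGroup.mk_surjective N)
  have : Group.FG ψ.ker :=
    (Group.fg_iff_subgroup_fg _).2 (fg_subgroup_of_lowerCentralSeries_eq_bot c hE _)
  exact Group.IsFinitelyPresented.of_surjective ψ hψ (.of_FG _)

/-! ### Residual finiteness -/

theorem finite_of_finite_center (G : Type*) [Group G] [Group.IsNilpotent G] :
    Group.FG G → Finite (center G) → Finite G := by
  refine Group.nilpotent_center_quotient_ind
    (P := fun G _ _ => Group.FG G → Finite (center G) → Finite G) G ?_ ?_
  · intros; infer_instance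
  · intro G _ _ ih hG hZ
    obtain ⟨S, hS, hfin⟩ := Group.fg_iff.1 hG
    have : Finite S := hfin
    have hcent : ∀ y ∈ (center (G ⧸ center G)), ∀ s : G, ∀ x : G, (x : G ⧸ center G) = y →
        ⁅x, s⁆ ∈ center G := by
      rintro y hy s x rfl
      rw [← QuotientGroup.eq_one_iff]
      change QuotientGroup.mk' _ ⁅x, s⁆ = 1
      rw [map_commutatorElement, commutatorElement_eq_one_iff_mul_comm]
      exact (mem_center_iff.1 hy _).symm
    have hfc : Finite (center (G ⧸ center G)) := by
      -- An element of the second centre is determined modulo the centre by its commutators with the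
      -- generators, which are central; hence finitely many possibilities.
      let f : center (G ⧸ center G) → (S → center G) := fun y s =>
        ⟨⁅y.1.out, s.1⁆, hcent y.1 y.2 s.1 _ (QuotientGroup.out_eq' y.1)⟩
      refine Finite.of_injective f fun y z hyz => ?_
      have h : ∀ s ∈ S, ⁅y.1.out, s⁆ = ⁅z.1.out, s⁆ := fun s hs =>
        congrArg Subtype.val (congrFun hyz ⟨s, hs⟩)
      have hmem : y.1.out⁻¹ * z.1.out ∈ center G := by
        have : closure S ≤ centralizer {y.1.out⁻¹ * z.1.out} := by
          rw [closure_le]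
          intro s hs
          refine mem_centralizer_singleton_iff.2 ?_
          have h1 := h s hs
          rw [commutatorElement_def, commutatorElement_def, mul_left_inj] at h1
          calc s * (y.1.out⁻¹ * z.1.out)
              = y.1.out⁻¹ * (y.1.out * s * y.1.out⁻¹) * z.1.out := by group
            _ = y.1.out⁻¹ * z.1.out * s := by rw [h1]; group
        rw [hS] at this
        rw [mem_center_iff]
        exact fun g => mem_centralizer_singleton_iff.1 (this (mem_top g))
      ext
      rw [← QuotientGroup.out_eq' y.1, ← QuotientGroup.out_eq' z.1]
      exact QuotientGroup.eq.2 hmem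
    have hq : Finite (G ⧸ center G) :=
      ih (Group.fg_of_surjective (QuotientGroup.mk'_surjective _)) hfc
    exact (finite_iff_subgroup_quotient (center G)).2 ⟨hZ, hq⟩

/-- Finitely generated nilpotent groups are residually finite. -/
theorem residuallyFinite_of_isNilpotent (G : Type*) [Group G] [Group.FG G]
    [Group.IsNilpotent G] : Group.ResiduallyFinite G := by
  refine Group.residuallyFinite_iff_exists_finiteIndexNormalSubgroup.2 fun g hg => ?_
  -- Take `N` maximal among normal subgroups avoiding `g`. Every nontrivial normal subgroup of `G ⧸
  -- N` then contains the image of `g`, and this forces the quotient to be finite.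
  obtain ⟨N, -, hN⟩ := zorn_le_nonempty₀ {N : Subgroup G | N.Normal ∧ g ∉ N} (by
    intro c hc hchain y hy
    refine ⟨sSup c, ⟨?_, ?_⟩, fun z hz => le_sSup hz⟩
    · refine ⟨fun x hx a => ?_⟩
      obtain ⟨K, hK, hxK⟩ := (mem_sSup_of_directedOn ⟨y, hy⟩ hchain.directedOn).1 hx
      exact le_sSup hK ((hc hK).1.conj_mem x hxK a)
    · intro h
      obtain ⟨K, hK, hgK⟩ := (mem_sSup_of_directedOn ⟨y, hy⟩ hchain.directedOn).1 h
      exact (hc hK).2 hgK) ⊥ ⟨inferInstance, by simpa using hg⟩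
  have hNn : N.Normal := hN.prop.1
  have key : ∀ K : Subgroup (G ⧸ N), K.Normal → K ≠ ⊥ → (g : G ⧸ N) ∈ K := by
    intro K hK hne
    by_contra hgK
    have h1 : K.comap (QuotientGroup.mk' N) ≤ N :=
      hN.le_of_ge ⟨inferInstance, hgK⟩ (QuotientGroup.le_comap_mk' N K)
    refine hne (le_bot_iff.1 fun x hx => ?_)
    obtain ⟨x, rfl⟩ := QuotientGroup.mk'_surjective N x
    exact (QuotientGroup.eq_one_iff x).2 (h1 hx)
  have hfg : Group.FG (G ⧸ N) := Group.fg_of_surjective (QuotientGroup.mk'_surjective N)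
  have htor : ∀ z ∈ center (G ⧸ N), IsOfFinOrder z := by
    intro z hz
    have hnorm : ∀ n : ℤ, (zpowers (z ^ n)).Normal := fun n => by
      refine ⟨fun x hx y => ?_⟩
      have hxz : x ∈ center (G ⧸ N) := (zpowers_le.2 (zpow_mem hz n)) hx
      rwa [mem_center_iff.1 hxz y, mul_inv_cancel_right]
    by_contra hinf
    have hinj := injective_zpow_iff_not_isOfFinOrder.2 hinf
    have h1 := key _ (hnorm 1) (by
      rw [zpow_one, Ne, zpowers_eq_bot]
      rintro rfl
      exact hinf IsOfFinOrder.one)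
    rw [zpow_one] at h1
    obtain ⟨a, ha⟩ := mem_zpowers_iff.1 h1
    have ha0 : a ≠ 0 := by
      rintro rfl
      exact hN.prop.2 ((QuotientGroup.eq_one_iff g).1 (by rw [← ha, zpow_zero]))
    -- If `z` has infinite order and `g` maps to `z ^ a`, then `g` would also map into the powers of
    -- `z ^ (2 * a)`, giving `a = 2 * a * b` with `a ≠ 0`.
    have h2 := key _ (hnorm (2 * a)) (by
      rw [Ne, zpowers_eq_bot, ← zpow_zero z]
      exact fun h => by have := hinj h; omega)
    obtain ⟨b, hb⟩ := mem_zpowers_iff.1 h2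
    rw [← ha, ← zpow_mul] at hb
    have h3 := hinj hb
    have h4 : a * (2 * b - 1) = 0 := by linarith
    rcases mul_eq_zero.1 h4 with h | h <;> omega
  have hZ : Finite (center (G ⧸ N)) :=
    finite_of_le_center (fg_subgroup_of_isNilpotent _) le_rfl htor
  have hfin := finite_of_finite_center (G ⧸ N) hfg hZ
  have : N.FiniteIndex := Subgroup.finiteIndex_of_finite_quotient
  exact ⟨.ofSubgroup N, hN.prop.2⟩

end GroupLaw

namespace GroupLaw

open scoped commutatorElement

/-! ### Operations on words and their primitive recursiveness -/

/-- A word in the letters `x₀, x₁, …` and their inverses. -/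
abbrev Word := List (ℕ × Bool)

section Helpers

variable {α β : Type*} [Primcodable α] [Primcodable β]

theorem primrecPred_forall_mem {f : α → List β} {p : α → β → Prop} (hf : Primrec f)
    (hp : PrimrecRel p) : PrimrecPred fun a => ∀ b ∈ f a, p a b :=
  (PrimrecRel.forall_mem_list hp.swap).comp hf Primrec.id

theorem primrecPred_exists_lt {f : α → ℕ} {p : α → ℕ → Prop} (hf : Primrec f)
    (hp : PrimrecRel p) : PrimrecPred fun a => ∃ n < f a, p a n :=
  ((PrimrecRel.exists_mem_list hp.swap).comp (Primrec.list_range.comp hf) Primrec.id).of_eq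
    fun a => by simp

theorem primrec_decode_getD : Primrec fun e : ℕ => (Encodable.decode (α := List β) e).getD [] :=
  Primrec.option_getD.comp Primrec.decode (Primrec.const [])

end Helpers

theorem primrec_invRev : Primrec (FreeGroup.invRev : Word → Word) :=
  Primrec.list_reverse.comp <| Primrec.list_map Primrec.id <|
    (Primrec.pair (Primrec.fst.comp Primrec.snd)
      (Primrec.not.comp (Primrec.snd.comp Primrec.snd)) : Primrec _)

/-- A form of free reduction to which `Primrec.list_foldr` applies. -/
theorem reduce_eq_foldr (u : Word) : FreeGroup.reduce u = u.foldr (fun l v =>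
    if v.head? = some (l.1, !l.2) then v.tail else l :: v) [] := by
  induction u with
  | nil => rfl
  | cons l u ih =>
    rw [FreeGroup.reduce.cons, List.foldr_cons, ← ih]
    rcases FreeGroup.reduce u with _ | ⟨⟨j, b⟩, v⟩
    · simp
    · obtain ⟨i, c⟩ := l
      cases b <;> cases c <;> simp [eq_comm]

theorem primrec_reduce : Primrec (FreeGroup.reduce : Word → Word) := by
  refine Primrec.of_eq (Primrec.list_foldr (h := fun _ p =>
    if p.2.head? = some (p.1.1, !p.1.2) then p.2.tail else p.1 :: p.2) Primrec.id
    (Primrec.const []) ?_) fun u => (reduce_eq_foldr u).symm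
  have h1 : Primrec fun p : Word × (ℕ × Bool) × Word => p.2.2 := Primrec.snd.comp Primrec.snd
  have h2 : Primrec fun p : Word × (ℕ × Bool) × Word => p.2.1 := Primrec.fst.comp Primrec.snd
  refine Primrec.ite (Primrec.eq.comp (Primrec.list_head?.comp h1)
    (Primrec.option_some.comp (Primrec.pair (Primrec.fst.comp h2)
      (Primrec.not.comp (Primrec.snd.comp h2))))) (Primrec.list_tail.comp h1)
    (Primrec.list_cons.comp h2 h1)

theorem primrecRel_mk_eq : PrimrecRel fun u v : Word => FreeGroup.mk u = FreeGroup.mk v :=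
  (Primrec.eq.comp (primrec_reduce.comp Primrec.fst) (primrec_reduce.comp Primrec.snd)).of_eq
    fun p => by rw [← FreeGroup.toWord_mk, ← FreeGroup.toWord_mk, FreeGroup.toWord_inj]

/-- The result of substituting the words listed in `S` for the letters of `w`; the letters
beyond the length of `S` are deleted. -/
def subst (S : List Word) (w : Word) : Word :=
  w.flatMap fun l => bif l.2 then S.getD l.1 [] else FreeGroup.invRev (S.getD l.1 [])

theorem mk_subst (S : List Word) (w : Word) : FreeGroup.mk (subst S w) =
    FreeGroup.lift (fun j => FreeGroup.mk (S.getD j [])) (FreeGroup.mk w) := by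
  induction w with
  | nil => rfl
  | cons l w ih =>
    rw [subst, List.flatMap_cons, ← FreeGroup.mul_mk, ← subst, ih]
    obtain ⟨j, _ | _⟩ := l <;> simp [FreeGroup.inv_mk]

theorem primrec_subst : Primrec₂ subst := by
  have h : Primrec fun p : (List Word × Word) × ℕ × Bool => p.1.1.getD p.2.1 [] :=
    (Primrec.list_getD []).comp (Primrec.fst.comp Primrec.fst) (Primrec.fst.comp Primrec.snd)
  exact Primrec.list_flatMap Primrec.snd
    (Primrec.cond (Primrec.snd.comp Primrec.snd) h (primrec_invRev.comp h))

/-- The product of the conjugates of relators, or inverses of relators, in the list `C`. -/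
def conjProduct (R : List Word) (C : List (Word × ℕ × Bool)) : Word :=
  C.flatMap fun a => a.1 ++ subst R [a.2] ++ FreeGroup.invRev a.1

theorem primrec_conjProduct : Primrec₂ conjProduct := by
  have h1 : Primrec fun p : (List Word × List (Word × ℕ × Bool)) × Word × ℕ × Bool => p.2.1 :=
    Primrec.fst.comp Primrec.snd
  refine Primrec.list_flatMap Primrec.snd (Primrec.list_append.comp (Primrec.list_append.comp h1
    (primrec_subst.comp (Primrec.fst.comp Primrec.fst) (Primrec.list_cons.comp
      (Primrec.snd.comp Primrec.snd) (Primrec.const [])))) (primrec_invRev.comp h1))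

/-- The word `u` is shown to be a consequence of the relators `R` by a derivation
with code less than `n`. -/
def HasDerivation (R : List Word) (n : ℕ) (u : Word) : Prop :=
  ∃ e < n, FreeGroup.mk u = FreeGroup.mk (conjProduct R ((Encodable.decode e).getD []))

theorem primrecPred_hasDerivation {α : Type*} [Primcodable α] {R : α → List Word} {n : α → ℕ}
    {u : α → Word} (hR : Primrec R) (hn : Primrec n) (hu : Primrec u) :
    PrimrecPred fun a => HasDerivation (R a) (n a) (u a) :=
  primrecPred_exists_lt hn <| primrecRel_mk_eq.comp (hu.comp Primrec.fst)
    (primrec_conjProduct.comp (hR.comp Primrec.fst) (primrec_decode_getD.comp Primrec.snd))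

theorem HasDerivation.mono {R : List Word} {m n : ℕ} (hmn : m ≤ n) {u : Word}
    (h : HasDerivation R m u) : HasDerivation R n u :=
  let ⟨e, he, h⟩ := h
  ⟨e, he.trans_le hmn, h⟩

/-- Consequences of the relators are exactly the products of conjugates of relators and their
inverses, so enumerating codes of such products semi-decides membership. -/
theorem mk_mem_normalClosure_iff (R : List Word) (u : Word) :
    FreeGroup.mk u ∈ Subgroup.normalClosure {r | ∃ v ∈ R, r = FreeGroup.mk v} ↔
      ∃ n, HasDerivation R n u := by
  set N := Subgroup.normalClosure {r : FreeGroup ℕ | ∃ v ∈ R, r = FreeGroup.mk v} with hN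
  have hmk : ∀ a : Word × ℕ × Bool, FreeGroup.mk (a.1 ++ subst R [a.2] ++ FreeGroup.invRev a.1) =
      FreeGroup.mk a.1 * FreeGroup.mk (subst R [a.2]) * (FreeGroup.mk a.1)⁻¹ := fun a => by
    rw [FreeGroup.inv_mk, FreeGroup.mul_mk, FreeGroup.mul_mk]
  have happ : ∀ C C', FreeGroup.mk (conjProduct R (C ++ C')) =
      FreeGroup.mk (conjProduct R C) * FreeGroup.mk (conjProduct R C') := fun C C' => by
    rw [FreeGroup.mul_mk, conjProduct, List.flatMap_append]; rfl
  have hsingle : ∀ a, FreeGroup.mk (conjProduct R [a]) =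
      FreeGroup.mk a.1 * FreeGroup.mk (subst R [a.2]) * (FreeGroup.mk a.1)⁻¹ := fun a => by
    rw [← hmk]; simp [conjProduct]
  have hlet : ∀ l : ℕ × Bool, FreeGroup.mk (subst R [l]) =
      bif l.2 then FreeGroup.mk (R.getD l.1 []) else (FreeGroup.mk (R.getD l.1 []))⁻¹ := by
    rintro ⟨j, _ | _⟩ <;> simp [subst, FreeGroup.inv_mk]
  constructor
  · intro h
    suffices ∀ x ∈ N, ∃ C, x = FreeGroup.mk (conjProduct R C) by
      obtain ⟨C, hC⟩ := this _ h
      exact ⟨Encodable.encode C + 1, Encodable.encode C, Nat.lt_succ_self _, by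
        rw [Encodable.encodek]; exact hC⟩
    intro x hx
    induction hx using Subgroup.closure_induction with
    | mem x hx =>
      obtain ⟨_, ⟨v, hv, rfl⟩, hx⟩ := Group.mem_conjugatesOfSet_iff.1 hx
      obtain ⟨g, rfl⟩ := isConj_iff.1 hx
      obtain ⟨j, hj, rfl⟩ := List.mem_iff_getElem.1 hv
      refine ⟨[(g.toWord, j, true)], ?_⟩
      rw [hsingle, hlet, FreeGroup.mk_toWord]
      simp [hj]
    | one => exact ⟨[], rfl⟩
    | mul x y _ _ hx hy =>
      obtain ⟨C, rfl⟩ := hx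
      obtain ⟨C', rfl⟩ := hy
      exact ⟨C ++ C', (happ C C').symm⟩
    | inv x _ hx =>
      obtain ⟨C, rfl⟩ := hx
      refine ⟨(C.map fun a => (a.1, a.2.1, !a.2.2)).reverse, ?_⟩
      clear * - happ hsingle hlet
      induction C with
      | nil => rfl
      | cons a C ih =>
        rw [← List.singleton_append, happ, mul_inv_rev, ih, List.map_append, List.reverse_append,
          happ]
        congr 1
        simp only [List.map_cons, List.map_nil, List.reverse_singleton, hsingle, hlet]
        obtain ⟨g, j, _ | _⟩ := a <;> simp
  · rintro ⟨n, e, -, he⟩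
    rw [he]
    generalize (Encodable.decode (α := List (Word × ℕ × Bool)) e).getD [] = C
    induction C with
    | nil => exact one_mem N
    | cons a C ih =>
      rw [← List.singleton_append, happ]
      refine mul_mem ?_ ih
      rw [hsingle, hlet]
      refine Subgroup.normalClosure_normal.conj_mem _ ?_ _
      have hj : FreeGroup.mk (R.getD a.2.1 []) ∈ N := by
        rcases lt_or_ge a.2.1 R.length with h | h
        · refine Subgroup.subset_normalClosure ⟨_, ?_, rfl⟩
          rw [List.getD_eq_getElem _ _ h]
          exact List.getElem_mem h
        · rw [List.getD_eq_default _ _ h]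
          exact one_mem N
      cases a.2.2
      · exact inv_mem hj
      · exact hj

/-! ### Finite lists of words -/

/-- All lists of length `n` with entries in `A`. -/
def tuples {α : Type*} (A : List α) : ℕ → List (List α)
  | 0 => [[]]
  | n + 1 => (tuples A n).flatMap fun t => A.map fun a => a :: t

theorem mem_tuples {α : Type*} {A : List α} {n : ℕ} {t : List α} :
    t ∈ tuples A n ↔ t.length = n ∧ ∀ a ∈ t, a ∈ A := by
  induction n generalizing t with
  | zero => cases t <;> simp [tuples]
  | succ n ih =>
    cases t with
    | nil => simp [tuples]
    | cons a t => simp [tuples, ih]; tauto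

theorem primrec_tuples {α : Type*} [Primcodable α] :
    Primrec₂ (tuples : List α → ℕ → List (List α)) := by
  refine Primrec₂.of_eq (Primrec.nat_rec (f := fun _ : List α => [[]]) (g := fun A p =>
    p.2.flatMap fun t => A.map fun a => a :: t) (Primrec.const _) ?_) fun A n => ?_
  · refine Primrec.list_flatMap (Primrec.snd.comp Primrec.snd) ?_
    refine Primrec.list_map (Primrec.fst.comp Primrec.fst) ?_
    exact Primrec.list_cons.comp Primrec.snd (Primrec.snd.comp Primrec.fst)
  · induction n with
    | zero => rfl
    | succ n ih => simp only [tuples, ← ih]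

/-- The letters `x₀, …, x_{m-1}` and their inverses. -/
def letters (m : ℕ) : Word :=
  (List.range m).flatMap fun i => [(i, true), (i, false)]

theorem mem_letters {m : ℕ} {l : ℕ × Bool} : l ∈ letters m ↔ l.1 < m := by
  obtain ⟨i, _ | _⟩ := l <;> simp [letters]

theorem primrec_letters : Primrec letters :=
  Primrec.list_flatMap Primrec.list_range <| Primrec.list_cons.comp
    (Primrec.pair Primrec.snd (Primrec.const true)) <| Primrec.list_cons.comp
    (Primrec.pair Primrec.snd (Primrec.const false)) (Primrec.const [])

/-- The words of length at most `c` in the letters `x₀, …, x_{m-1}` and their inverses. -/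
def shortWords (m c : ℕ) : List Word :=
  (List.range (c + 1)).flatMap (tuples (letters m))

theorem mem_shortWords {m c : ℕ} {u : Word} :
    u ∈ shortWords m c ↔ u.length ≤ c ∧ ∀ l ∈ u, l.1 < m := by
  simp [shortWords, mem_tuples, mem_letters]

theorem primrec_shortWords : Primrec₂ shortWords :=
  Primrec.list_flatMap (Primrec.list_range.comp (Primrec.succ.comp Primrec.snd))
    (primrec_tuples.comp (primrec_letters.comp (Primrec.fst.comp Primrec.fst)) Primrec.snd)

/-- The left-normed commutators of `c + 1` of the letters `x₀, …, x_{m-1}`. -/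
def commutatorWords (m : ℕ) : ℕ → List Word
  | 0 => (List.range m).map fun i => [(i, true)]
  | c + 1 => (commutatorWords m c).flatMap fun u => (List.range m).map fun i =>
      u ++ [(i, true)] ++ FreeGroup.invRev u ++ [(i, false)]

theorem primrec_commutatorWords : Primrec₂ commutatorWords := by
  refine Primrec₂.of_eq (Primrec.nat_rec
    (f := fun m : ℕ => (List.range m).map fun i => [(i, true)])
    (g := fun m p => p.2.flatMap fun u => (List.range m).map fun i =>
      u ++ [(i, true)] ++ FreeGroup.invRev u ++ [(i, false)]) ?_ ?_) fun m c => ?_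
  · exact Primrec.list_map Primrec.list_range (Primrec.list_cons.comp
      (Primrec.pair Primrec.snd (Primrec.const true)) (Primrec.const []))
  · refine Primrec.list_flatMap (Primrec.snd.comp Primrec.snd) ?_
    refine Primrec.list_map (Primrec.list_range.comp (Primrec.fst.comp Primrec.fst)) ?_
    have h1 : Primrec fun p : ((ℕ × ℕ × List Word) × Word) × ℕ => p.1.2 :=
      Primrec.snd.comp Primrec.fst
    have h2 : ∀ b : Bool, Primrec fun p : ((ℕ × ℕ × List Word) × Word) × ℕ => [(p.2, b)] :=
      fun b => Primrec.list_cons.comp (Primrec.pair Primrec.snd (Primrec.const b))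
        (Primrec.const [])
    exact Primrec.list_append.comp (Primrec.list_append.comp (Primrec.list_append.comp h1 (h2 _))
      (primrec_invRev.comp h1)) (h2 _)
  · induction c with
    | zero => rfl
    | succ c ih => simp only [commutatorWords, ← ih]

theorem mk_commutatorWords (m c : ℕ) :
    {x | ∃ u ∈ commutatorWords m c, x = FreeGroup.mk u} =
      leftNormedCommutators {x | ∃ i < m, x = FreeGroup.of i} c := by
  induction c with
  | zero =>
    ext x
    simp [commutatorWords, leftNormedCommutators, FreeGroup.of]
  | succ c ih =>
    ext x
    rw [leftNormedCommutators, ← ih]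
    simp only [commutatorWords, List.mem_flatMap, List.mem_map, List.mem_range,
      Set.mem_ofPred_eq]
    have key : ∀ (u : Word) (i : ℕ), FreeGroup.mk (u ++ [(i, true)] ++ FreeGroup.invRev u ++
        [(i, false)]) = ⁅FreeGroup.mk u, FreeGroup.of i⁆ := fun u i => by
      rw [commutatorElement_def, FreeGroup.of, FreeGroup.inv_mk, FreeGroup.inv_mk,
        FreeGroup.mul_mk, FreeGroup.mul_mk, FreeGroup.mul_mk]
      rfl
    constructor
    · rintro ⟨_, ⟨u, hu, i, hi, rfl⟩, rfl⟩
      exact ⟨_, ⟨u, hu, rfl⟩, _, ⟨i, hi, rfl⟩, key u i⟩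
    · rintro ⟨_, ⟨u, hu, rfl⟩, _, ⟨i, hi, rfl⟩, rfl⟩
      exact ⟨_, ⟨u, hu, i, hi, rfl⟩, (key u i).symm⟩

/-! ### Finitary permutations of `ℕ` -/

/-- The image of `p` under the product of the transpositions listed in `L`. -/
def moveBy (L : List (ℕ × ℕ)) (p : ℕ) : ℕ :=
  L.foldr (fun a q => if q = a.1 then a.2 else if q = a.2 then a.1 else q) p

/-- The image of `p` under the word `u`, where the letter `xᵢ` acts as the product of the
transpositions in the `i`th entry of `T`. -/
def move (T : List (List (ℕ × ℕ))) (u : Word) (p : ℕ) : ℕ :=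
  u.foldr (fun l q => moveBy (bif l.2 then T.getD l.1 [] else (T.getD l.1 []).reverse) q) p

theorem primrec_moveBy : Primrec₂ moveBy := by
  refine Primrec.list_foldr (h := fun _ (p : (ℕ × ℕ) × ℕ) =>
    if p.2 = p.1.1 then p.1.2 else if p.2 = p.1.2 then p.1.1 else p.2) Primrec.fst Primrec.snd ?_
  have h1 : Primrec fun p : (List (ℕ × ℕ) × ℕ) × (ℕ × ℕ) × ℕ => p.2.1.1 :=
    Primrec.fst.comp (Primrec.fst.comp Primrec.snd)
  have h2 : Primrec fun p : (List (ℕ × ℕ) × ℕ) × (ℕ × ℕ) × ℕ => p.2.1.2 :=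
    Primrec.snd.comp (Primrec.fst.comp Primrec.snd)
  have h3 : Primrec fun p : (List (ℕ × ℕ) × ℕ) × (ℕ × ℕ) × ℕ => p.2.2 :=
    Primrec.snd.comp Primrec.snd
  exact Primrec.ite (Primrec.eq.comp h3 h1) h2 (Primrec.ite (Primrec.eq.comp h3 h2) h1 h3)

theorem primrec_move : Primrec fun a : List (List (ℕ × ℕ)) × Word × ℕ => move a.1 a.2.1 a.2.2 := by
  refine Primrec.list_foldr (h := fun (a : List (List (ℕ × ℕ)) × Word × ℕ)
    (p : (ℕ × Bool) × ℕ) => moveBy (bif p.1.2 then a.1.getD p.1.1 []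
    else (a.1.getD p.1.1 []).reverse) p.2) (Primrec.fst.comp Primrec.snd)
    (Primrec.snd.comp Primrec.snd) ?_
  have h : Primrec fun p : (List (List (ℕ × ℕ)) × Word × ℕ) × (ℕ × Bool) × ℕ =>
      p.1.1.getD p.2.1.1 [] :=
    (Primrec.list_getD []).comp (Primrec.fst.comp Primrec.fst)
      (Primrec.fst.comp (Primrec.fst.comp Primrec.snd))
  exact primrec_moveBy.comp (Primrec.cond (Primrec.snd.comp (Primrec.fst.comp Primrec.snd)) h
    (Primrec.list_reverse.comp h)) (Primrec.snd.comp Primrec.snd)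

theorem primrec_move_comp {α : Type*} [Primcodable α] {f : α → List (List (ℕ × ℕ))}
    {g : α → Word} {h : α → ℕ} (hf : Primrec f) (hg : Primrec g) (hh : Primrec h) :
    Primrec fun a => move (f a) (g a) (h a) :=
  primrec_move.comp (g := fun a => (f a, g a, h a)) (Primrec.pair hf (Primrec.pair hg hh))

/-- The product of the transpositions listed in `L`. -/
def swapProd (L : List (ℕ × ℕ)) : Equiv.Perm ℕ :=
  (L.map fun a => Equiv.swap a.1 a.2).prod

theorem moveBy_eq (L : List (ℕ × ℕ)) (p : ℕ) : moveBy L p = swapProd L p := by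
  induction L with
  | nil => rfl
  | cons a L ih =>
    rw [moveBy, List.foldr_cons, ← moveBy, ih, ← Equiv.swap_apply_def, ← Equiv.Perm.mul_apply]
    rfl

theorem swapProd_reverse (L : List (ℕ × ℕ)) : swapProd L.reverse = (swapProd L)⁻¹ := by
  simp [swapProd, List.prod_inv_reverse, List.map_reverse, Function.comp_def]

/-- The permutation action of the free group in which the letter `xᵢ` acts as the product of the
transpositions in the `i`th entry of `T`. -/
def permHom (T : List (List (ℕ × ℕ))) : FreeGroup ℕ →* Equiv.Perm ℕ :=
  FreeGroup.lift fun i => swapProd (T.getD i [])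

theorem move_eq (T : List (List (ℕ × ℕ))) (u : Word) (p : ℕ) :
    move T u p = permHom T (FreeGroup.mk u) p := by
  induction u with
  | nil => rfl
  | cons l u ih =>
    rw [move, List.foldr_cons, ← move, ih, ← List.singleton_append, ← FreeGroup.mul_mk, map_mul,
      Equiv.Perm.mul_apply, moveBy_eq]
    obtain ⟨i, _ | _⟩ := l <;> simp [permHom, swapProd_reverse]

/-- The points that occur in `T`. -/
def points (T : List (List (ℕ × ℕ))) : List ℕ :=
  T.flatten.flatMap fun a => [a.1, a.2]

theorem primrec_points : Primrec points :=
  Primrec.list_flatMap Primrec.list_flatten <| Primrec.list_cons.comp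
    (Primrec.fst.comp Primrec.snd) <| Primrec.list_cons.comp
    (Primrec.snd.comp Primrec.snd) (Primrec.const [])

theorem swapProd_apply_of_notMem {L : List (ℕ × ℕ)} {p : ℕ} (h : ∀ a ∈ L, p ≠ a.1 ∧ p ≠ a.2) :
    swapProd L p = p := by
  induction L with
  | nil => rfl
  | cons a L ih =>
    rw [List.forall_mem_cons] at h
    rw [swapProd, List.map_cons, List.prod_cons, ← swapProd, Equiv.Perm.mul_apply, ih h.2,
      Equiv.swap_apply_of_ne_of_ne h.1.1 h.1.2]

/-- This makes the relator test finite: only the points occurring in `T` have to be checked. -/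
theorem permHom_apply_of_notMem {T : List (List (ℕ × ℕ))} {p : ℕ} (h : p ∉ points T)
    (x : FreeGroup ℕ) : permHom T x p = p := by
  have hr : (permHom T).range ≤ MulAction.stabilizer (Equiv.Perm ℕ) p := by
    refine FreeGroup.range_lift_le (Set.range_subset_iff.2 fun i => ?_)
    refine swapProd_apply_of_notMem fun a ha => ?_
    rcases lt_or_ge i T.length with hi | hi
    · rw [List.getD_eq_getElem _ _ hi] at ha
      have : ∀ q, (q = a.1 ∨ q = a.2) → q ∈ points T := fun q hq =>
        List.mem_flatMap.2 ⟨a, List.mem_flatten.2 ⟨_, List.getElem_mem hi, ha⟩, by simpa using hq⟩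
      exact ⟨fun e => h (this p (.inl e)), fun e => h (this p (.inr e))⟩
    · rw [List.getD_eq_default _ _ hi] at ha
      simp at ha
  exact hr ⟨x, rfl⟩

/-! ### The two searches -/

/-- A finite presentation, the number of variables, and a word. -/
abbrev Input := (ℕ × List Word) × (ℕ × Word)

/-- Among the derivations with codes less than `n` there are enough to show that the group is
nilpotent of some class `c < n` and that the word vanishes on all short tuples. -/
def LawCertificate (a : Input) (n : ℕ) : Prop :=
  ∃ c < n, (∀ u ∈ commutatorWords a.1.1 c, HasDerivation a.1.2 n u) ∧
    ∀ S ∈ tuples (shortWords a.1.1 c) a.2.1, HasDerivation a.1.2 n (subst S a.2.2)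

theorem primrecRel_lawCertificate : PrimrecRel LawCertificate := by
  refine primrecPred_exists_lt (p := fun (b : Input × ℕ) c => (∀ u ∈ commutatorWords b.1.1.1 c,
    HasDerivation b.1.1.2 b.2 u) ∧ ∀ S ∈ tuples (shortWords b.1.1.1 c) b.1.2.1,
    HasDerivation b.1.1.2 b.2 (subst S b.1.2.2)) Primrec.snd ?_
  have ha : Primrec fun q : (Input × ℕ) × ℕ => q.1.1 := Primrec.fst.comp Primrec.fst
  have hm : Primrec fun q : (Input × ℕ) × ℕ => q.1.1.1.1 :=
    Primrec.fst.comp (Primrec.fst.comp ha)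
  have hR : Primrec fun q : (Input × ℕ) × ℕ => q.1.1.1.2 :=
    Primrec.snd.comp (Primrec.fst.comp ha)
  have hk : Primrec fun q : (Input × ℕ) × ℕ => q.1.1.2.1 :=
    Primrec.fst.comp (Primrec.snd.comp ha)
  have hw : Primrec fun q : (Input × ℕ) × ℕ => q.1.1.2.2 :=
    Primrec.snd.comp (Primrec.snd.comp ha)
  have hn : Primrec fun q : (Input × ℕ) × ℕ => q.1.2 := Primrec.snd.comp Primrec.fst
  refine PrimrecPred.and (primrecPred_forall_mem (primrec_commutatorWords.comp hm Primrec.snd) ?_)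
    (primrecPred_forall_mem (primrec_tuples.comp (primrec_shortWords.comp hm Primrec.snd) hk) ?_)
  · exact primrecPred_hasDerivation (hR.comp Primrec.fst) (hn.comp Primrec.fst) Primrec.snd
  · exact primrecPred_hasDerivation (hR.comp Primrec.fst) (hn.comp Primrec.fst)
      (primrec_subst.comp Primrec.snd (hw.comp Primrec.fst))

/-- The data of a finite permutation action in which a value of a word moves a point. -/
abbrev Refutation := List (List (ℕ × ℕ)) × List Word × ℕ

/-- The permutations satisfy the relators and the value of the word moves the point. -/
def Refutes (a : Input) (b : Refutation) : Prop :=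
  (b.1.length ≤ a.1.1 ∧ b.2.1.length ≤ a.2.1) ∧
    (∀ r ∈ a.1.2, ∀ p ∈ points b.1, move b.1 r p = p) ∧
      move b.1 (subst b.2.1 a.2.2) b.2.2 ≠ b.2.2

theorem primrecRel_refutes : PrimrecRel Refutes := by
  have hm : Primrec fun q : Input × Refutation => q.1.1.1 :=
    Primrec.fst.comp (Primrec.fst.comp Primrec.fst)
  have hR : Primrec fun q : Input × Refutation => q.1.1.2 :=
    Primrec.snd.comp (Primrec.fst.comp Primrec.fst)
  have hk : Primrec fun q : Input × Refutation => q.1.2.1 :=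
    Primrec.fst.comp (Primrec.snd.comp Primrec.fst)
  have hw : Primrec fun q : Input × Refutation => q.1.2.2 :=
    Primrec.snd.comp (Primrec.snd.comp Primrec.fst)
  have hT : Primrec fun q : Input × Refutation => q.2.1 := Primrec.fst.comp Primrec.snd
  have hS : Primrec fun q : Input × Refutation => q.2.2.1 :=
    Primrec.fst.comp (Primrec.snd.comp Primrec.snd)
  have hp : Primrec fun q : Input × Refutation => q.2.2.2 :=
    Primrec.snd.comp (Primrec.snd.comp Primrec.snd)
  have h1 : PrimrecPred fun q : Input × Refutation => q.2.1.length ≤ q.1.1.1 :=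
    Primrec.nat_le.comp (Primrec.list_length.comp hT) hm
  have h2 : PrimrecPred fun q : Input × Refutation => q.2.2.1.length ≤ q.1.2.1 :=
    Primrec.nat_le.comp (Primrec.list_length.comp hS) hk
  have h3 : PrimrecPred fun q : ((Input × Refutation) × Word) × ℕ =>
      move q.1.1.2.1 q.1.2 q.2 = q.2 := by
    have h : Primrec fun q : ((Input × Refutation) × Word) × ℕ => move q.1.1.2.1 q.1.2 q.2 :=
      primrec_move_comp (hT.comp (Primrec.fst.comp Primrec.fst))
        (Primrec.snd.comp Primrec.fst) Primrec.snd
    exact Primrec.eq.comp h Primrec.snd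
  have h4 : PrimrecPred fun q : (Input × Refutation) × Word =>
      ∀ p ∈ points q.1.2.1, move q.1.2.1 q.2 p = p :=
    primrecPred_forall_mem (primrec_points.comp (hT.comp Primrec.fst)) h3
  have h5 : PrimrecPred fun q : Input × Refutation =>
      ∀ r ∈ q.1.1.2, ∀ p ∈ points q.2.1, move q.2.1 r p = p :=
    primrecPred_forall_mem hR h4
  have h6 : PrimrecPred fun q : Input × Refutation =>
      move q.2.1 (subst q.2.2.1 q.1.2.2) q.2.2.2 = q.2.2.2 := by
    have h : Primrec fun q : Input × Refutation =>
        move q.2.1 (subst q.2.2.1 q.1.2.2) q.2.2.2 :=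
      primrec_move_comp hT (primrec_subst.comp hS hw) hp
    exact Primrec.eq.comp h hp
  exact PrimrecPred.and (PrimrecPred.and h1 h2) (PrimrecPred.and h5 (PrimrecPred.not h6))

/-- The number `n` is the code of a refutation. -/
def NonlawCertificate (a : Input) (n : ℕ) : Prop :=
  Refutes a ((Encodable.decode n).getD ([], [], 0))

theorem primrecRel_nonlawCertificate : PrimrecRel NonlawCertificate :=
  primrecRel_refutes.comp Primrec.fst
    (Primrec.option_getD.comp (Primrec.decode.comp Primrec.snd) (Primrec.const ([], [], 0)))

open Classical in
/-- The simultaneous search for certificates of both kinds. -/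
noncomputable def decideLaw (a : Input) : Part Bool :=
  Nat.rfindOpt fun n => if LawCertificate a n then some true else
    if NonlawCertificate a n then some false else none

theorem partrec_decideLaw : Partrec decideLaw := by
  classical
  refine Partrec.rfindOpt (Primrec.to_comp ?_)
  exact Primrec.ite primrecRel_lawCertificate (Primrec.const _)
    (Primrec.ite primrecRel_nonlawCertificate (Primrec.const _) (Primrec.const _))

/-- Both kinds of certificate are sound, so they never coexist and the order of the tests is
immaterial; completeness makes the search halt. -/
theorem exists_mem_decideLaw {a : Input} {p : Prop} (h1 : p ↔ ∃ n, LawCertificate a n)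
    (h2 : ¬ p ↔ ∃ n, NonlawCertificate a n) : ∃ b, b ∈ decideLaw a ∧ (b = true ↔ p) := by
  classical
  have hdom : (decideLaw a).Dom := by
    rw [decideLaw, Nat.rfindOpt_dom]
    by_cases hp : p
    · obtain ⟨n, hn⟩ := h1.1 hp
      exact ⟨n, true, by simp [hn]⟩
    · obtain ⟨n, hn⟩ := h2.1 hp
      exact ⟨n, false, by
        have : ¬ LawCertificate a n := fun h => hp (h1.2 ⟨n, h⟩)
        simp [hn, this]⟩
  refine ⟨_, Part.get_mem hdom, ?_⟩
  obtain ⟨n, hn⟩ := Nat.rfindOpt_spec (Part.get_mem hdom)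
  split_ifs at hn with h h'
  · have e : true = (decideLaw a).get hdom := by simpa using hn
    simp only [← e, true_iff]
    exact h1.2 ⟨n, h⟩
  · have e : false = (decideLaw a).get hdom := by simpa using hn
    simp only [← e, Bool.false_eq_true, false_iff]
    exact h2.2 ⟨n, h'⟩
  · simp at hn

end GroupLaw

namespace GroupLaw

/-! ### Laws and verbal subgroups -/

theorem isLaw_iff {α G : Type*} [Group G] {w : FreeGroup α} :
    IsLaw w G ↔ ∀ g : α → G, FreeGroup.lift g w = 1 := by
  constructor
  · intro h g
    have : FreeGroup.lift g w ∈ values w G := ⟨g, rfl⟩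
    rwa [h] at this
  · intro h
    ext x
    constructor
    · rintro ⟨g, rfl⟩
      exact h g
    · rintro rfl
      exact ⟨fun _ => 1, (h _).symm⟩

theorem isLaw_map_iff {k : ℕ} {G : Type*} [Group G] {w : FreeGroup (Fin k)} :
    IsLaw (FreeGroup.map Fin.val w) G ↔ IsLaw w G := by
  simp only [isLaw_iff]
  have key : ∀ g : ℕ → G, FreeGroup.lift g (FreeGroup.map Fin.val w) =
      FreeGroup.lift (fun j : Fin k => g j) w := fun g => by
    have : (FreeGroup.lift g).comp (FreeGroup.map Fin.val) =
        FreeGroup.lift (fun j : Fin k => g j) := by ext j; simp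
    exact DFunLike.congr_fun this w
  refine ⟨fun h g => ?_, fun h g => (key g).trans (h _)⟩
  have := h fun j => if hj : j < k then g ⟨j, hj⟩ else 1
  rw [key] at this
  simpa using this

theorem mem_verbalSubgroup_laws_iff {k : ℕ} {G : Type*} [Group G] {w : FreeGroup (Fin k)} :
    w ∈ verbalSubgroup (laws G) (FreeGroup (Fin k)) ↔ IsLaw w G := by
  constructor
  · intro hw
    rw [isLaw_iff]
    intro g
    suffices verbalSubgroup (laws G) (FreeGroup (Fin k)) ≤ (FreeGroup.lift g).ker from this hw
    rw [verbalSubgroup, Subgroup.closure_le]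
    rintro _ ⟨v, hv, f, rfl⟩
    have : (FreeGroup.lift g).comp (FreeGroup.lift f) =
        FreeGroup.lift fun j => FreeGroup.lift g (f j) := by ext j; simp
    exact (DFunLike.congr_fun this v).trans (isLaw_iff.1 hv _)
  · intro hw
    -- Rename `w` into the variables indexed by `ℕ` and substitute the generators back.
    refine Subgroup.subset_closure ⟨_, isLaw_map_iff.2 hw,
      fun j => if hj : j < k then FreeGroup.of ⟨j, hj⟩ else 1, ?_⟩
    have : (FreeGroup.lift fun j => if hj : j < k then FreeGroup.of ⟨j, hj⟩ else 1).comp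
        (FreeGroup.map Fin.val) = MonoidHom.id (FreeGroup (Fin k)) := by ext j; simp
    exact (DFunLike.congr_fun this w).symm

/-- The word `w` vanishes for all values of the first `k` variables when the others are
set equal to `1`. -/
def IsLawBelow (G : Type*) [Group G] (k : ℕ) (w : Word) : Prop :=
  ∀ g : ℕ → G, (∀ j, ¬ j < k → g j = 1) → FreeGroup.lift g (FreeGroup.mk w) = 1

theorem mk_code {k : ℕ} (u : List (Fin k × Bool)) :
    FreeGroup.mk (code u) = FreeGroup.map Fin.val (FreeGroup.mk u) := by
  rw [FreeGroup.map.mk]; rfl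

theorem isLawBelow_code_iff {k : ℕ} {G : Type*} [Group G] (w : List (Fin k × Bool)) :
    IsLawBelow G k (code w) ↔ IsLaw (FreeGroup.mk w) G := by
  have key : ∀ g : ℕ → G, FreeGroup.lift g (FreeGroup.mk (code w)) =
      FreeGroup.lift (fun j : Fin k => g j) (FreeGroup.mk w) := fun g => by
    have : (FreeGroup.lift g).comp (FreeGroup.map Fin.val) =
        FreeGroup.lift (fun j : Fin k => g j) := by ext j; simp
    rw [mk_code]
    exact DFunLike.congr_fun this (FreeGroup.mk w)
  rw [isLaw_iff]
  constructor
  · intro h g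
    have := h (fun j => if hj : j < k then g ⟨j, hj⟩ else 1) fun j hj => dif_neg hj
    rw [key] at this
    simpa using this
  · intro h g _
    rw [key, h]

theorem prod_map_mk {α G : Type*} [Group G] (f : FreeGroup α →* G) (L : List (α × Bool)) :
    (L.map fun l => f (FreeGroup.mk [l])).prod = f (FreeGroup.mk L) := by
  induction L with
  | nil => exact (map_one f).symm
  | cons l L ih =>
    rw [List.map_cons, List.prod_cons, ih, ← map_mul, FreeGroup.mul_mk, List.singleton_append]

theorem exists_swapProd_eq_viaEmbedding {Q : Type*} [Finite Q] (i : Q ↪ ℕ) (f : Equiv.Perm Q) :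
    ∃ L, swapProd L = Equiv.Perm.viaEmbeddingHom i f := by
  classical
  induction f using Equiv.Perm.swap_induction_on with
  | one => exact ⟨[], (map_one _).symm⟩
  | swap_mul f x y hxy ih =>
    obtain ⟨L, hL⟩ := ih
    refine ⟨(i x, i y) :: L, ?_⟩
    rw [map_mul, ← hL, swapProd, List.map_cons, List.prod_cons, ← swapProd]
    congr 1
    ext p
    rw [Equiv.Perm.viaEmbeddingHom_apply]
    by_cases hp : p ∈ Set.range i
    · obtain ⟨q, rfl⟩ := hp
      rw [Equiv.Perm.viaEmbedding_apply, i.injective.map_swap]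
    · rw [Equiv.Perm.viaEmbedding_apply_of_notMem _ _ _ hp, Equiv.swap_apply_of_ne_of_ne]
      · rintro rfl; exact hp ⟨x, rfl⟩
      · rintro rfl; exact hp ⟨y, rfl⟩

/-- A nontrivial element of a residually finite group acts nontrivially in an action of the group
by finitary permutations of `ℕ`. -/
theorem exists_perm_hom {G : Type*} [Group G] [Group.ResiduallyFinite G] {g : G} (hg : g ≠ 1) :
    ∃ Θ : G →* Equiv.Perm ℕ, Θ g ≠ 1 ∧ ∀ x, ∃ L, swapProd L = Θ x := by
  obtain ⟨H, hH⟩ := Group.exists_finiteIndexNormalSubgroup_notMem g hg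
  obtain ⟨i, hi⟩ := Countable.exists_injective_nat (G ⧸ H.toSubgroup)
  -- The regular action on a finite quotient that detects `g`, transported to `ℕ`.
  refine ⟨(Equiv.Perm.viaEmbeddingHom ⟨i, hi⟩).comp ((MulAction.toPermHom (G ⧸ H.toSubgroup)
    (G ⧸ H.toSubgroup)).comp (QuotientGroup.mk' H.toSubgroup)), fun h => hH ?_,
    fun x => exists_swapProd_eq_viaEmbedding _ _⟩
  have h1 := Equiv.Perm.viaEmbeddingHom_injective ⟨i, hi⟩ (h.trans (map_one _).symm)
  have h2 := MulAction.toPerm_injective (h1.trans (map_one (MulAction.toPermHom _ _)).symm)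
  exact (QuotientGroup.eq_one_iff g).1 h2

/-! ### Presentations -/

/-- The embedding of the free group on the first `m` letters. -/
abbrev inclHom (m : ℕ) : FreeGroup (Fin m) →* FreeGroup ℕ := FreeGroup.map Fin.val

/-- The retraction on the free group on the first `m` letters. -/
def retractHom (m : ℕ) : FreeGroup ℕ →* FreeGroup (Fin m) :=
  FreeGroup.lift fun i => if hi : i < m then FreeGroup.of ⟨i, hi⟩ else 1

theorem retractHom_inclHom {m : ℕ} (x : FreeGroup (Fin m)) : retractHom m (inclHom m x) = x := by
  have : (retractHom m).comp (inclHom m) = MonoidHom.id _ := by ext i; simp [retractHom]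
  exact DFunLike.congr_fun this x

/-- The normal closure of the words in the list `R`. -/
abbrev relSubgroup (R : List Word) : Subgroup (FreeGroup ℕ) :=
  Subgroup.normalClosure {r | ∃ v ∈ R, r = FreeGroup.mk v}

theorem mk_mem_range_inclHom {m : ℕ} {u : Word} (hu : ∀ l ∈ u, l.1 < m) :
    FreeGroup.mk u ∈ (inclHom m).range := by
  induction u with
  | nil => exact one_mem _
  | cons l u ih =>
    rw [List.forall_mem_cons] at hu
    rw [← List.singleton_append, ← FreeGroup.mul_mk]
    exact mul_mem ⟨FreeGroup.mk [(⟨l.1, hu.1⟩, l.2)], rfl⟩ (ih hu.2)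

theorem mk_subst_mem {S : List Word} {H : Subgroup (FreeGroup ℕ)}
    (hS : ∀ u ∈ S, FreeGroup.mk u ∈ H) (w : Word) : FreeGroup.mk (subst S w) ∈ H := by
  rw [mk_subst]
  refine FreeGroup.range_lift_le (Set.range_subset_iff.2 fun j => ?_) ⟨_, rfl⟩
  rcases lt_or_ge j S.length with h | h
  · rw [List.getD_eq_getElem _ _ h]
    exact hS _ (List.getElem_mem h)
  · rw [List.getD_eq_default _ _ h]
    exact one_mem H

theorem setOf_of_lt (m : ℕ) : {x | ∃ i < m, x = FreeGroup.of i} =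
    inclHom m '' Set.range FreeGroup.of := by
  ext x
  constructor
  · rintro ⟨i, hi, rfl⟩
    exact ⟨_, ⟨⟨i, hi⟩, rfl⟩, by simp⟩
  · rintro ⟨_, ⟨i, rfl⟩, rfl⟩
    exact ⟨i, i.2, by simp⟩

/-! ### Soundness and completeness of the two certificates -/

section Presentation

variable {G : Type*} [Group G] {m : ℕ} {R : List Word} {φ : FreeGroup (Fin m) →* G}

/-- The surjection `φ` of the free group on `m` letters on `G` has as its kernel the consequences of
the words `R`. -/
structure IsPresentation (R : List Word) (φ : FreeGroup (Fin m) →* G) : Prop where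
  surjective : Function.Surjective φ
  eq_one_iff : ∀ x, φ x = 1 ↔ inclHom m x ∈ relSubgroup R
  -- Conjugators in a derivation may use letters beyond the first `m`; the retraction deletes them.
  retract_mem : ∀ x ∈ relSubgroup R, φ (retractHom m x) = 1

theorem Presents.exists_isPresentation {R : List (List (Fin m × Bool))} (h : Presents R G) :
    ∃ φ : FreeGroup (Fin m) →* G, IsPresentation (R.map code) φ := by
  obtain ⟨e⟩ := h
  set N : Set (FreeGroup (Fin m)) := {r | ∃ u ∈ R, r = FreeGroup.mk u} with hN
  have hmk : ∀ x, PresentedGroup.mk N x = 1 ↔ x ∈ Subgroup.normalClosure N := fun x =>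
    QuotientGroup.eq_one_iff x
  have h1 : Subgroup.normalClosure N ≤ (relSubgroup (R.map code)).comap (inclHom m) := by
    refine Subgroup.normalClosure_le_normal ?_
    rintro _ ⟨u, hu, rfl⟩
    exact Subgroup.subset_normalClosure ⟨code u, List.mem_map_of_mem hu, (mk_code u).symm⟩
  have h2 : relSubgroup (R.map code) ≤ (Subgroup.normalClosure N).comap (retractHom m) := by
    refine Subgroup.normalClosure_le_normal ?_
    rintro _ ⟨v, hv, rfl⟩
    obtain ⟨u, hu, rfl⟩ := List.mem_map.1 hv
    rw [SetLike.mem_coe, Subgroup.mem_comap, mk_code, retractHom_inclHom]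
    exact Subgroup.subset_normalClosure ⟨u, hu, rfl⟩
  refine ⟨e.toMonoidHom.comp (PresentedGroup.mk N),
    e.surjective.comp (PresentedGroup.mk_surjective N), fun x => ?_, fun x hx => ?_⟩
  · simp only [MonoidHom.comp_apply, MulEquiv.toMonoidHom_eq_coe, MonoidHom.coe_coe,
      EmbeddingLike.map_eq_one_iff, hmk]
    exact ⟨fun hx => h1 hx, fun hx => by simpa [retractHom_inclHom] using h2 hx⟩
  · simp only [MonoidHom.comp_apply, MulEquiv.toMonoidHom_eq_coe, MonoidHom.coe_coe,
      EmbeddingLike.map_eq_one_iff, hmk]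
    exact h2 hx

/-- The bridge between evaluating a word in `G` and the syntactic substitution performed by the
algorithm. -/
theorem lift_eq_retract (g : ℕ → G) (S : List Word)
    (hg : ∀ j, g j = φ (retractHom m (FreeGroup.mk (S.getD j [])))) (w : Word) :
    FreeGroup.lift g (FreeGroup.mk w) = φ (retractHom m (FreeGroup.mk (subst S w))) := by
  rw [mk_subst]
  have : (φ.comp (retractHom m)).comp (FreeGroup.lift fun j => FreeGroup.mk (S.getD j [])) =
      FreeGroup.lift g := by ext j; simp [hg]
  exact (DFunLike.congr_fun this _).symm

namespace IsPresentation

theorem retract_eq_one_iff (hφ : IsPresentation R φ) {x : FreeGroup ℕ}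
    (hx : x ∈ (inclHom m).range) :
    φ (retractHom m x) = 1 ↔ x ∈ relSubgroup R := by
  obtain ⟨x, rfl⟩ := hx
  rw [retractHom_inclHom, hφ.eq_one_iff]

theorem isLawBelow_of_lawCertificate (hφ : IsPresentation R φ) {k : ℕ} {w : Word} {n : ℕ}
    (h : LawCertificate ((m, R), (k, w)) n) : IsLawBelow G k w := by
  obtain ⟨c, -, h1, h2⟩ := h
  have hder : ∀ u, HasDerivation R n u → φ (retractHom m (FreeGroup.mk u)) = 1 := fun u hu =>
    hφ.retract_mem _ ((mk_mem_normalClosure_iff R u).2 ⟨n, hu⟩)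
  have hc : (⊤ : Subgroup G).lowerCentralSeries c = ⊥ := by
    refine lowerCentralSeries_eq_bot_of_leftNormedCommutators
      (S := φ '' Set.range FreeGroup.of) ?_ ?_
    · rw [← MonoidHom.map_closure, FreeGroup.closure_range_of,
        Subgroup.map_top_of_surjective _ hφ.surjective]
    · rw [← image_leftNormedCommutators]
      rintro _ ⟨x, hx, rfl⟩
      have hx' := Set.mem_image_of_mem (inclHom m) hx
      rw [image_leftNormedCommutators, ← setOf_of_lt, ← mk_commutatorWords] at hx'
      obtain ⟨u, hu, hxu⟩ := hx'
      rw [← retractHom_inclHom x, hxu]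
      exact hder u (h1 u hu)
  refine lift_eq_one_of_isShort hc (s := fun l : Fin m × Bool => φ (FreeGroup.mk [l])) ?_ _
    (Set.finite_lt_nat k) ?_
  · intro g
    obtain ⟨x, rfl⟩ := hφ.surjective g
    exact ⟨x.toWord, by rw [prod_map_mk, FreeGroup.mk_toWord]⟩
  · intro g hg hgk
    choose l hl hgl using hg
    rw [lift_eq_retract g ((List.range k).map fun j => code (l j))]
    · refine hder _ (h2 _ (mem_tuples.2 ⟨by simp, fun a ha => ?_⟩))
      obtain ⟨j, -, rfl⟩ := List.mem_map.1 ha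
      refine mem_shortWords.2 ⟨by simpa [code] using hl j, fun a ha => ?_⟩
      obtain ⟨b, -, rfl⟩ := List.mem_map.1 ha
      exact b.1.2
    · intro j
      by_cases hj : j < k
      · rw [List.getD_eq_getElem _ _ (by simpa using hj)]
        simp only [List.getElem_map, List.getElem_range, mk_code]
        rw [retractHom_inclHom, hgl, prod_map_mk]
      · rw [List.getD_eq_default _ _ (by simpa using hj), hgk j hj]
        exact (map_one (φ.comp (retractHom m))).symm

theorem exists_lawCertificate (hφ : IsPresentation R φ) [hn : Group.IsNilpotent G]
    {k : ℕ} {w : Word} (hw : IsLawBelow G k w) : ∃ n, LawCertificate ((m, R), (k, w)) n := by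
  obtain ⟨c, hc⟩ := Subgroup.nilpotent_iff_lowerCentralSeries.1 hn
  have hder : ∀ L : List Word, (∀ u ∈ L, FreeGroup.mk u ∈ (inclHom m).range ∧
      φ (retractHom m (FreeGroup.mk u)) = 1) → ∃ n, ∀ u ∈ L, HasDerivation R n u := by
    intro L hL
    induction L with
    | nil => exact ⟨0, by simp⟩
    | cons u L ih =>
      rw [List.forall_mem_cons] at hL
      obtain ⟨n, hn⟩ := ih hL.2
      obtain ⟨n', hn'⟩ := (mk_mem_normalClosure_iff R u).1
        ((hφ.retract_eq_one_iff hL.1.1).1 hL.1.2)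
      refine ⟨max n n', List.forall_mem_cons.2 ⟨hn'.mono (le_max_right _ _), fun v hv => ?_⟩⟩
      exact (hn v hv).mono (le_max_left _ _)
  obtain ⟨n₁, h1⟩ := hder (commutatorWords m c) fun u hu => by
    have h : FreeGroup.mk u ∈ {x | ∃ u ∈ commutatorWords m c, x = FreeGroup.mk u} := ⟨u, hu, rfl⟩
    rw [mk_commutatorWords, setOf_of_lt, ← image_leftNormedCommutators] at h
    obtain ⟨x, hx, hxu⟩ := h
    refine ⟨⟨x, hxu⟩, ?_⟩
    rw [← hxu, retractHom_inclHom]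
    have := leftNormedCommutators_subset _ c
      (image_leftNormedCommutators φ _ c ▸ Set.mem_image_of_mem φ hx)
    simpa [hc] using this
  obtain ⟨n₂, h2⟩ := hder ((tuples (shortWords m c) k).map fun S => subst S w) fun u hu => by
    obtain ⟨S, hS, rfl⟩ := List.mem_map.1 hu
    rw [mem_tuples] at hS
    refine ⟨mk_subst_mem (fun u hu => mk_mem_range_inclHom (mem_shortWords.1 (hS.2 u hu)).2) w, ?_⟩
    rw [← lift_eq_retract _ S fun _ => rfl]
    refine hw _ fun j hj => ?_
    rw [List.getD_eq_default _ _ (by omega)]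
    exact map_one (φ.comp (retractHom m))
  -- One bound serves both for the class and for the codes of all derivations.
  refine ⟨max (c + 1) (max n₁ n₂), c, lt_max_of_lt_left (Nat.lt_succ_self c),
    fun u hu => (h1 u hu).mono (by simp), fun S hS =>
    (h2 _ (List.mem_map_of_mem (f := fun S => subst S w) hS)).mono (by simp)⟩

theorem not_isLawBelow_of_nonlawCertificate (hφ : IsPresentation R φ) {k : ℕ} {w : Word} {n : ℕ}
    (h : NonlawCertificate ((m, R), (k, w)) n) : ¬ IsLawBelow G k w := by
  unfold NonlawCertificate at h
  generalize (Encodable.decode (α := Refutation) n).getD ([], [], 0) = b at h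
  obtain ⟨T, S, p⟩ := b
  obtain ⟨⟨hT, hS⟩, hR, hp⟩ := h
  dsimp only at hT hS hR hp
  have h1 : relSubgroup R ≤ (permHom T).ker := by
    refine Subgroup.normalClosure_le_normal ?_
    rintro _ ⟨r, hr, rfl⟩
    refine Equiv.ext fun q => ?_
    by_cases hq : q ∈ points T
    · rw [← move_eq]; exact hR r hr q hq
    · exact permHom_apply_of_notMem hq _
  have h2 : ∀ y, φ (retractHom m y) = 1 → permHom T y = 1 := by
    intro y hy
    -- Since `T` has at most `m` entries, later letters act trivially and the action factors through
    -- the retraction.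
    have : ((permHom T).comp (inclHom m)).comp (retractHom m) = permHom T := by
      ext1 i
      by_cases hi : i < m
      · simp [retractHom, hi]
      · have : T.getD i [] = [] := List.getD_eq_default _ _ (by omega)
        simp only [MonoidHom.comp_apply, retractHom, FreeGroup.lift_apply_of, hi, dite_false,
          map_one, permHom, this]
        rfl
    rw [← this]
    exact h1 ((hφ.eq_one_iff _).1 hy)
  intro hw
  refine hp ?_
  rw [move_eq, h2 _ ?_]
  · rfl
  rw [← lift_eq_retract _ S fun _ => rfl]
  refine hw _ fun j hj => ?_
  rw [List.getD_eq_default _ _ (by omega)]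
  exact map_one (φ.comp (retractHom m))

theorem exists_nonlawCertificate (hφ : IsPresentation R φ) [Group.FG G]
    [Group.IsNilpotent G] {k : ℕ} {w : Word} (hw : ¬ IsLawBelow G k w) : ∃ n, NonlawCertificate ((m, R), (k, w)) n := by
  have := residuallyFinite_of_isNilpotent G
  unfold IsLawBelow at hw
  push Not at hw
  obtain ⟨g, hgk, hg⟩ := hw
  obtain ⟨Θ, hΘ, hΘs⟩ := exists_perm_hom hg
  choose L hL using hΘs
  set ρ := φ.comp (retractHom m) with hρ
  have hu : ∀ j, ∃ u : Word, ρ (FreeGroup.mk u) = g j := fun j => by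
    obtain ⟨x, hx⟩ := hφ.surjective (g j)
    exact ⟨code x.toWord, by
      rw [mk_code, hρ, MonoidHom.comp_apply, retractHom_inclHom, FreeGroup.mk_toWord, hx]⟩
  choose u hu using hu
  set T := (List.range m).map fun i => L (ρ (FreeGroup.of i)) with hT
  set S := (List.range k).map u with hS
  -- The lists in `T` encode the finitary permutations by which the generators act, so the encoded
  -- action is the given one pulled back to words.
  have hperm : permHom T = Θ.comp ρ := by
    ext1 i
    rw [permHom, FreeGroup.lift_apply_of, MonoidHom.comp_apply]
    by_cases hi : i < m
    · rw [List.getD_eq_getElem _ _ (by simpa [hT] using hi)]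
      simp [hT, hL]
    · rw [List.getD_eq_default _ _ (by simpa [hT] using hi)]
      have : ρ (FreeGroup.of i) = 1 := by simp [hρ, retractHom, hi]
      rw [this, map_one]
      rfl
  have hgS : Θ (FreeGroup.lift g (FreeGroup.mk w)) = permHom T (FreeGroup.mk (subst S w)) := by
    rw [hperm, lift_eq_retract g S (φ := φ)]
    · rfl
    · intro j
      by_cases hj : j < k
      · rw [List.getD_eq_getElem _ _ (by simpa [hS] using hj)]
        simp only [hS, List.getElem_map, List.getElem_range]
        exact (hu j).symm
      · rw [List.getD_eq_default _ _ (by simpa [hS] using hj), hgk j (by omega)]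
        exact (map_one ρ).symm
  obtain ⟨p, hp⟩ : ∃ p, permHom T (FreeGroup.mk (subst S w)) p ≠ p := by
    by_contra! hall
    exact hΘ (hgS.trans (Equiv.ext hall))
  refine ⟨Encodable.encode ((T, S, p) : Refutation), ?_⟩
  rw [NonlawCertificate, Encodable.encodek]
  refine ⟨⟨by simp [hT], by simp [hS]⟩, fun r hr q _ => ?_, ?_⟩
  · have : ρ (FreeGroup.mk r) = 1 :=
      hφ.retract_mem _ (Subgroup.subset_normalClosure ⟨r, hr, rfl⟩)
    rw [Option.getD_some, move_eq, hperm, MonoidHom.comp_apply, this, map_one]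
    rfl
  · rw [Option.getD_some, move_eq]
    exact hp

theorem exists_mem_decideLaw (hφ : IsPresentation R φ) [Group.FG G] [Group.IsNilpotent G]
    (k : ℕ) (w : Word) :
    ∃ b, b ∈ decideLaw ((m, R), (k, w)) ∧ (b = true ↔ IsLawBelow G k w) :=
  GroupLaw.exists_mem_decideLaw
    ⟨hφ.exists_lawCertificate, fun ⟨_, h⟩ => hφ.isLawBelow_of_lawCertificate h⟩
    ⟨hφ.exists_nonlawCertificate, fun ⟨_, h⟩ => hφ.not_isLawBelow_of_nonlawCertificate h⟩

end IsPresentation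

end Presentation

theorem exists_presents (G : Type*) [Group G] [Group.IsFinitelyPresented G] :
    ∃ (m : ℕ) (R : List (List (Fin m × Bool))), Presents R G := by
  obtain ⟨m, s, hs, ⟨e⟩⟩ := Group.IsFinitelyPresented.exists_mulEquiv_presentedGroup (G := G)
  refine ⟨m, hs.toFinset.toList.map FreeGroup.toWord, ?_⟩
  have : {r : FreeGroup (Fin m) | ∃ u ∈ hs.toFinset.toList.map FreeGroup.toWord,
      r = FreeGroup.mk u} = s := by
    ext r
    constructor
    · rintro ⟨_, hu, rfl⟩
      obtain ⟨x, hx, rfl⟩ := List.mem_map.1 hu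
      rw [FreeGroup.mk_toWord]
      simpa using hx
    · intro hr
      exact ⟨r.toWord, List.mem_map_of_mem (by simpa using hr), FreeGroup.mk_toWord.symm⟩
  rw [Presents, this]
  exact ⟨e.symm⟩

end GroupLaw

theorem lemma6p1 :
    -- for a fixed group: being a law is membership in the verbal subgroup, and it is decidable
    (∀ (Γ : Type*) [Group Γ], Group.FG Γ → Group.IsNilpotent Γ →
      (∀ g : Γ, g ≠ 1 → ¬ IsOfFinOrder g) →
      (∀ (k : ℕ) (w : FreeGroup (Fin k)),
        w ∈ GroupLaw.verbalSubgroup (GroupLaw.laws Γ) (FreeGroup (Fin k)) ↔ GroupLaw.IsLaw w Γ) ∧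
      ∃ D : ℕ × List (ℕ × Bool) → Bool, Computable D ∧
        ∀ (k : ℕ) (w : List (Fin k × Bool)),
          D (k, GroupLaw.code w) = true ↔
            FreeGroup.mk w ∈ GroupLaw.verbalSubgroup (GroupLaw.laws Γ) (FreeGroup (Fin k))) ∧
    -- one algorithm for all such groups, with a finite presentation of the group as a further input
    (∃ D : (ℕ × List (List (ℕ × Bool))) × (ℕ × List (ℕ × Bool)) →. Bool, Partrec D ∧
      ∀ (Γ : Type*) [Group Γ], Group.FG Γ → Group.IsNilpotent Γ →
        (∀ g : Γ, g ≠ 1 → ¬ IsOfFinOrder g) →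
        ∀ (m : ℕ) (R : List (List (Fin m × Bool))), GroupLaw.Presents R Γ →
          ∀ (k : ℕ) (w : List (Fin k × Bool)),
            ∃ b : Bool, b ∈ D ((m, R.map GroupLaw.code), (k, GroupLaw.code w)) ∧
              (b = true ↔
                FreeGroup.mk w ∈
                  GroupLaw.verbalSubgroup (GroupLaw.laws Γ) (FreeGroup (Fin k)))) := by
  refine ⟨fun Γ _ hfg hnil _ => ⟨fun k w => GroupLaw.mem_verbalSubgroup_laws_iff, ?_⟩,
    GroupLaw.decideLaw, GroupLaw.partrec_decideLaw, fun Γ _ hfg hnil _ m R hR k w => ?_⟩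
  · have := GroupLaw.isFinitelyPresented_of_isNilpotent Γ
    obtain ⟨m, R, hR⟩ := GroupLaw.exists_presents Γ
    obtain ⟨φ, hφ⟩ := hR.exists_isPresentation
    -- With the presentation fixed, the search halts on every pair of an alphabet size and a word,
    -- so it defines a total function.
    choose D hD hD' using fun a : ℕ × GroupLaw.Word => hφ.exists_mem_decideLaw a.1 a.2
    refine ⟨D, ?_, fun k w => ?_⟩
    · refine (GroupLaw.partrec_decideLaw.comp (Computable.pair
        (Computable.const (m, R.map GroupLaw.code)) Computable.id)).of_eq fun a => ?_
      exact Part.eq_some_iff.2 (hD a)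
    · rw [hD', GroupLaw.isLawBelow_code_iff, GroupLaw.mem_verbalSubgroup_laws_iff]
  · obtain ⟨φ, hφ⟩ := hR.exists_isPresentation
    obtain ⟨b, hb, hb'⟩ := hφ.exists_mem_decideLaw k (GroupLaw.code w)
    refine ⟨b, hb, ?_⟩
    rw [hb', GroupLaw.isLawBelow_code_iff, GroupLaw.mem_verbalSubgroup_laws_iff]
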